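/- Let $\Gamma\subset \mathrm{SL}_2(\mathbb C)$ be a finite group, let $U_0,\dots,U_n$ be its simple complex representations up to isomorphism, with $U_0=\mathbb C$ trivial, and let $c_{ijk}=\dim\operatorname{Hom}_\Gamma(U_i\otimes U_j,U_k)$. Put $\mathrm{GL}=\prod_{i=1}^n \mathrm{GL}(U_i)$ (with $g_0=1$ for $g\in \mathrm{GL}$) and fix a decomposition of $\mathbb C^2$ into simple $\Gamma$-representations, through which $\mathrm{GL}$ acts on $\mathbb C^2$. A Clebsch–Gordan datum is a family $\varphi=(\varphi_{ij})$ of linear maps $\varphi_{ij}:U_i\otimes U_j\to\bigoplus_k U_k^{\oplus c_{ijk}}$. The group $\mathrm{GL}$ acts by $(g\varphi)_{ij}=(\bigoplus_k g_k^{\oplus c_{ijk}})\circ\varphi_{ij}\circ(g_i^{-1}\otimes g_j^{-1})$. The datum is regular if every $\varphi_{ij}$ is an isomorphism of $\Gamma$-representations and all $\varphi_{0i}$, $\varphi_{i0}$ are the identity. For a regular datum $\varphi^{(0)}$ let $\mathrm{CG}_\Gamma=\overline{\mathrm{GL}\,\varphi^{(0)}}$. Let $\overline Q$ be the Kleinian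 (McKay) double quiver: its vertices are $0,\dots,n$, and its arrows from $i$ to $j$ are indexed by a simple summand $U_p$ of $\mathbb C^2$ and a copy of $U_j$ in $\bigoplus_k U_k^{\oplus c_{ipk}}$, so that there are $\dim\operatorname{Hom}_\Gamma(U_i\otimes\mathbb C^2,U_j)$ of them. Let $Q$ be a quiver whose double is $\overline Q$, i.e. an arrow-reversing involution $a\mapsto a^*$ of $\overline Q$ together with a choice of exactly one arrow out of each pair $\{a,a^*\}$. Put $\alpha=(\dim U_i)_i$, and let $\operatorname{Rep}(\Pi_Q,\alpha)$ be the variety of the representations of $\overline Q$ on the spaces $U_i$ that satisfy the preprojective relations $\sum_{a\in Q,\,h(a)=v}aa^*=\sum_{a\in Q,\,t(a)=v}a^*a$ at all vertices $v$. Let $R(\varphi,x)=\varphi(-\otimes x)$ be the representation of $\overline Q$ whose arrows are the components of the maps $u\mapsto\varphi_{ip}(u\otimes x_p)$, where $x_p$ is the component of $x\in\mathbb C^2$ in the summand $U_p$. Then: 1. There are $Q$ and a regular datum $\varphi^{(0)}$ such that $R$ maps $\mathrm{CG}_\Gamma\times\mathbb C^2$ into $\operatorname{Rep}(\Pi_Q,\alpha)$.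 2. Let $Q$ and a regular datum $\varphi^{(0)}$ be any choice such that the representations $R(\varphi^{(0)},x)$, $x\in\mathbb C^2$, satisfy the preprojective relations. Then $R$ maps $\mathrm{CG}_\Gamma\times\mathbb C^2$ into $\operatorname{Rep}(\Pi_Q,\alpha)$. The pullback $R^*$ is an isomorphism of $\mathbb C$-algebras $$R^*:\ \mathbb C[\operatorname{Rep}(\Pi_Q,\alpha)]^{\mathrm{GL}}\ \xrightarrow{\ \sim\ }\ \mathbb C[\mathrm{CG}_\Gamma\times\mathbb C^2]^{\mathrm{GL}},$$ and the restriction $\pi$ to $\{\varphi^{(0)}\}\times\mathbb C^2$ is an isomorphism of $\mathbb C$-algebras $$\pi:\ \mathbb C[\mathrm{CG}_\Gamma\times\mathbb C^2]^{\mathrm{GL}}\ \xrightarrow{\ \sim\ }\ \mathbb C[X,Y]^{\operatorname{Stab}_{\mathrm{GL}}(\varphi^{(0)})}.$$ In particular $\pi\circ R^*$ is an isomorphism. -/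

import Mathlib

open scoped TensorProduct

noncomputable section

namespace ClebschGordan

/-! ### Regular functions on subsets of a finite-dimensional complex vector space -/

/-- The coordinate ring of `X ⊆ W`: the functions on `X` that are restrictions of polynomial
functions on the vector space `W`, i.e. the algebra generated by the linear forms. -/
def coordRing {W : Type} [AddCommGroup W] [Module ℂ W] (X : Set W) : Subalgebra ℂ (X → ℂ) :=
  Algebra.adjoin ℂ (Set.range fun (l : Module.Dual ℂ W) (x : X) => l (x : W))

/-- The Zariski closure of `X ⊆ W`. -/
def zariskiClosure {W : Type} [AddCommGroup W] [Module ℂ W] (X : Set W) : Set W :=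
  {w | ∀ f ∈ coordRing (Set.univ : Set W), (∀ x ∈ X, f ⟨x, trivial⟩ = 0) → f ⟨w, trivial⟩ = 0}

/-- The invariant ring `ℂ[X]^G`, for `act` an action of `G` on `W` that preserves `X`. -/
def invariantRing {G W : Type} [AddCommGroup W] [Module ℂ W] (act : G → W → W) (X : Set W) :
    Subalgebra ℂ (X → ℂ) where
  carrier := {f | f ∈ coordRing X ∧ ∀ (g : G) (x y : X), act g x = y → f y = f x}
  mul_mem' := fun ha hb => ⟨mul_mem ha.1 hb.1, fun g x y h => by
    simp only [Pi.mul_apply, ha.2 g x y h, hb.2 g x y h]⟩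
  add_mem' := fun ha hb => ⟨add_mem ha.1 hb.1, fun g x y h => by
    simp only [Pi.add_apply, ha.2 g x y h, hb.2 g x y h]⟩
  algebraMap_mem' := fun r => ⟨Subalgebra.algebraMap_mem _ r, fun _ _ _ _ => rfl⟩

/-! ### Simple representations and Clebsch-Gordan data -/

/-- A complete list without repetition of the simple complex representations of `Γ`, up to
isomorphism, written in coordinates. The entry `zero` is the trivial representation. -/
structure SimpleReps (Γ : Type) [Group Γ] (I : Type) where
  zero : I
  dim : I → ℕ
  rep : ∀ i, Representation ℂ Γ (Fin (dim i) → ℂ)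
  simple : ∀ i, (rep i).IsIrreducible
  eq_of_equiv : ∀ i j, Nonempty ((rep i).Equiv (rep j)) → i = j
  exists_equiv : ∀ (d : ℕ) (σ : Representation ℂ Γ (Fin d → ℂ)), σ.IsIrreducible →
    ∃ i, Nonempty (σ.Equiv (rep i))
  dim_zero : dim zero = 1
  rep_zero : ∀ g, rep zero g = LinearMap.id

variable {Γ : Type} [Group Γ] {I : Type}

/-- The underlying vector space of the simple representation with index `i`. -/
abbrev SimpleReps.U (S : SimpleReps Γ I) (i : I) : Type := Fin (S.dim i) → ℂ

/-- The unit vector `1` of the one-dimensional space `U₀`. -/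
def SimpleReps.one (S : SimpleReps Γ I) : S.U S.zero := fun _ => 1

/-- The Clebsch-Gordan coefficient: the multiplicity of `U k` in `U i ⊗ U j`. -/
def SimpleReps.cg (S : SimpleReps Γ I) (i j k : I) : ℕ :=
  Module.finrank ℂ (((S.rep i).tprod (S.rep j)).IntertwiningMap (S.rep k))

/-- A Clebsch-Gordan datum: bilinear maps from `U i × U j` to the direct sum over `k` of
`cg i j k` copies of `U k`. The component in the `s`-th copy of `U k` is `φ i j u v k s`. -/
abbrev CGDatum (S : SimpleReps Γ I) : Type :=
  ∀ i j : I, S.U i →ₗ[ℂ] S.U j →ₗ[ℂ] (∀ k : I, Fin (S.cg i j k) → S.U k)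

/-- Regular data: every `φ i j` is an isomorphism of `Γ`-representations from the tensor product,
and the components `φ 0 i` and `φ i 0` are the identity (upon `U 0 = ℂ`). -/
structure IsRegular (S : SimpleReps Γ I) (φ : CGDatum S) : Prop where
  bijective : ∀ i j, Function.Bijective (TensorProduct.lift (φ i j))
  equivariant : ∀ (g : Γ) (i j : I) (u : S.U i) (v : S.U j) (k : I) (s : Fin (S.cg i j k)),
    φ i j (S.rep i g u) (S.rep j g v) k s = S.rep k g (φ i j u v k s)
  zero_left : ∀ (i : I) (u : S.U i) (s : Fin (S.cg S.zero i i)), φ S.zero i S.one u i s = u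
  zero_right : ∀ (i : I) (u : S.U i) (s : Fin (S.cg i S.zero i)), φ i S.zero u S.one i s = u

/-- The gauge group: the product of the `GL (U i)` over the nontrivial simple representations,
realised as the families indexed by all `i` whose entry at the trivial representation is `1`. -/
def gaugeGroup (S : SimpleReps Γ I) : Subgroup (∀ i, S.U i ≃ₗ[ℂ] S.U i) where
  carrier := {g | g S.zero = 1}
  mul_mem' := fun {a b} (ha : a S.zero = 1) (hb : b S.zero = 1) => by
    simp [ha, hb]
  one_mem' := rfl
  inv_mem' := fun {a} (ha : a S.zero = 1) => by
    simp [ha]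

/-- Change of basis: `(gφ) i j = (⊕ g k) ∘ φ i j ∘ ((g i)⁻¹ ⊗ (g j)⁻¹)`. -/
def gaugeCG (S : SimpleReps Γ I) (g : gaugeGroup S) (φ : CGDatum S) : CGDatum S := fun i j =>
  (LinearMap.pi fun k => LinearMap.pi fun s =>
      (g.1 k).toLinearMap ∘ₗ LinearMap.proj (φ := fun _ : Fin (S.cg i j k) => S.U k) s ∘ₗ
        LinearMap.proj (φ := fun k => Fin (S.cg i j k) → S.U k) k).compRight ℂ ∘ₗ
    (φ i j).compl₁₂ (g.1 i).symm.toLinearMap (g.1 j).symm.toLinearMap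

theorem gaugeCG_apply (S : SimpleReps Γ I) (g : gaugeGroup S) (φ : CGDatum S) (i j : I)
    (u : S.U i) (v : S.U j) (k : I) (s : Fin (S.cg i j k)) :
    gaugeCG S g φ i j u v k s = g.1 k (φ i j ((g.1 i).symm u) ((g.1 j).symm v) k s) := rfl

/-- The Clebsch-Gordan variety: the closure of the gauge orbit of `φ₀`. -/
def cgVariety (S : SimpleReps Γ I) (φ₀ : CGDatum S) : Set (CGDatum S) :=
  zariskiClosure (Set.range fun g : gaugeGroup S => gaugeCG S g φ₀)

theorem self_mem_cgVariety (S : SimpleReps Γ I) (φ₀ : CGDatum S) : φ₀ ∈ cgVariety S φ₀ :=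
  fun _ _ h => h _ ⟨1, rfl⟩

/-! ### The Kleinian setting -/

variable {Γ : Subgroup (Matrix.SpecialLinearGroup (Fin 2) ℂ)}

/-- A decomposition of the natural representation `ℂ²` of `Γ ⊂ SL₂(ℂ)` into simple
representations: a `Γ`-equivariant isomorphism from `ℂ²` to `⊕ k, U (p k)`. -/
structure Decomposition (S : SimpleReps Γ I) (K : Type) where
  p : K → I
  iso : (Fin 2 → ℂ) ≃ₗ[ℂ] (∀ k : K, S.U (p k))
  equivariant : ∀ (g : Γ) (x : Fin 2 → ℂ) (k : K),
    iso (g.1.1.mulVec x) k = S.rep (p k) g (iso x k)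

variable {K : Type}

/-- The action of the gauge group on `ℂ²`, through the decomposition into simples. -/
def gaugePlane (S : SimpleReps Γ I) (D : Decomposition S K) (g : gaugeGroup S)
    (x : Fin 2 → ℂ) : Fin 2 → ℂ :=
  D.iso.symm fun k => g.1 (D.p k) (D.iso x k)

/-- The diagonal action of the gauge group on pairs `(φ, x)`. -/
def gaugePair (S : SimpleReps Γ I) (D : Decomposition S K) (g : gaugeGroup S)
    (z : CGDatum S × (Fin 2 → ℂ)) : CGDatum S × (Fin 2 → ℂ) :=
  (gaugeCG S g z.1, gaugePlane S D g z.2)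

/-- The arrows from `i` to `j` in the Kleinian double quiver. There are `dim Hom_Γ(U i ⊗ ℂ², U j)`
of them: one for each simple summand `U (p k)` of `ℂ²` and each copy of `U j` in
`U i ⊗ U (p k)`. -/
abbrev Arrow (S : SimpleReps Γ I) (D : Decomposition S K) (i j : I) : Type :=
  Σ k : K, Fin (S.cg i (D.p k) j)

/-- A quiver `Q` whose double quiver is the Kleinian double quiver: an involution `a ↦ a*` that
reverses arrows, and a set `Q₁` of arrows (those with `pos a = true`) that contains exactly one of
`a`, `a*` for every arrow `a`. -/
structure KleinianQuiver (S : SimpleReps Γ I) (D : Decomposition S K) where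
  star : ∀ {i j : I}, Arrow S D i j → Arrow S D j i
  star_star : ∀ {i j : I} (a : Arrow S D i j), star (star a) = a
  pos : ∀ {i j : I}, Arrow S D i j → Bool
  pos_star : ∀ {i j : I} (a : Arrow S D i j), pos (star a) = !pos a

/-- Representations of the double quiver with dimension vector `α i = dim (U i)`. -/
abbrev DoubleRep (S : SimpleReps Γ I) (D : Decomposition S K) : Type :=
  ∀ i j : I, Arrow S D i j → (S.U i →ₗ[ℂ] S.U j)

/-- The action of the gauge group on representations of the double quiver. -/
def gaugeRep (S : SimpleReps Γ I) (D : Decomposition S K) (g : gaugeGroup S)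
    (ρ : DoubleRep S D) : DoubleRep S D :=
  fun i j a => (g.1 j).toLinearMap ∘ₗ ρ i j a ∘ₗ (g.1 i).symm.toLinearMap

/-- `Rep(Π_Q, α)`: the representations that satisfy the preprojective relations. At the vertex `v`
the relation is `∑ a a* = ∑ a* a`, where the left sum runs over the arrows `a` of `Q` with head `v`
and the right sum over those with tail `v`. -/
def preprojectiveRep [Fintype I] [Fintype K] (S : SimpleReps Γ I) (D : Decomposition S K)
    (Q : KleinianQuiver S D) : Set (DoubleRep S D) :=
  {ρ | ∀ v : I,
    (∑ i : I, ∑ a : Arrow S D i v, if Q.pos a then ρ i v a ∘ₗ ρ v i (Q.star a) else 0) =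
    ∑ j : I, ∑ a : Arrow S D v j, if Q.pos a then ρ j v (Q.star a) ∘ₗ ρ v j a else 0}

/-- The comparison map `R(φ, x) = φ(- ⊗ x)`: the arrow from `i` to `j` with label `(k, s)` acts by
the component of `u ↦ φ(u ⊗ x_k)` in the `s`-th copy of `U j`. -/
def comparison (S : SimpleReps Γ I) (D : Decomposition S K) (z : CGDatum S × (Fin 2 → ℂ)) :
    DoubleRep S D := fun i j a =>
  LinearMap.proj (φ := fun _ : Fin (S.cg i (D.p a.1) j) => S.U j) a.2 ∘ₗ
    LinearMap.proj (φ := fun l => Fin (S.cg i (D.p a.1) l) → S.U l) j ∘ₗ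
      (z.1 i (D.p a.1)).flip (D.iso z.2 a.1)

theorem comparison_apply (S : SimpleReps Γ I) (D : Decomposition S K)
    (z : CGDatum S × (Fin 2 → ℂ)) (i j : I) (a : Arrow S D i j) (u : S.U i) :
    comparison S D z i j a u = z.1 i (D.p a.1) u (D.iso z.2 a.1) j a.2 := rfl

/-- The product `CG_Γ × ℂ²`. -/
def cgPlane (S : SimpleReps Γ I) (φ₀ : CGDatum S) : Set (CGDatum S × (Fin 2 → ℂ)) :=
  cgVariety S φ₀ ×ˢ Set.univ

/-- The points of `{φ₀} × ℂ² ⊂ CG_Γ × ℂ²`. -/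
def basePoint (S : SimpleReps Γ I) (φ₀ : CGDatum S) (x : Fin 2 → ℂ) : cgPlane S φ₀ :=
  ⟨(φ₀, x), self_mem_cgVariety S φ₀, trivial⟩

/-- The invariant ring `ℂ[X, Y]^Stab(φ₀)` for the stabilizer of `φ₀` in the gauge group. -/
def stabInvariants (S : SimpleReps Γ I) (D : Decomposition S K) (φ₀ : CGDatum S) :
    Subalgebra ℂ (MvPolynomial (Fin 2) ℂ) where
  carrier := {q | ∀ g : gaugeGroup S, gaugeCG S g φ₀ = φ₀ → ∀ x : Fin 2 → ℂ,
    MvPolynomial.eval (gaugePlane S D g x) q = MvPolynomial.eval x q}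
  mul_mem' := fun ha hb g hg x => by simp only [map_mul, ha g hg x, hb g hg x]
  add_mem' := fun ha hb g hg x => by simp only [map_add, ha g hg x, hb g hg x]
  algebraMap_mem' := fun r g hg x => by simp [MvPolynomial.algebraMap_eq]

end ClebschGordan

end

open scoped TensorProduct

noncomputable section

namespace ClebschGordan

/-! ### Regular functions -/

section CoordRing

variable {W W' : Type} [AddCommGroup W] [Module ℂ W] [AddCommGroup W'] [Module ℂ W']

/-! Both isomorphisms follow formally from three facts: `π ∘ R*` is surjective, `π` is injective and
`R*` is injective (`isomorphisms_of_regular`).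

Injectivity of `π` is density: an invariant function that vanishes on `{φ₀} × ℂ²` vanishes on the
product of the orbit of `φ₀` with `ℂ²`, hence on its closure.

Surjectivity of `π ∘ R*`: `Γ` maps into the stabilizer of `φ₀`, so a stabilizer-invariant `q` is
`Γ`-invariant. By `exists_pathFun_average`, the `Γ`-average of any map `x ↦ q(x) B` from `ℂ²` to
`Hom (U i, U j)` is a fixed linear combination of paths evaluated at `R(φ₀, x)`. The reason is that
the arrows out of `i` decompose `U i ⊗ ℂ²`, so that multiplication by a coordinate of `x` amounts to
one more arrow. Closed paths at the trivial vertex are gauge invariant, and with `B` a multiple of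
the identity they give `q` back.

Injectivity of `R*`: by `exists_forall_invariant_eq`, invariants cannot tell a preprojective
representation `ρ` from some `R(φ₀, x)`. The same decomposition of `U i ⊗ ℂ²` turns `ρ` into two
operators on the sum of the `Hom (U i, U i)` (`shiftOp`), and the preprojective relations make them
commute (`shiftOp_commute`). A joint eigenvector with eigenvalue `x ≠ 0` is a nonzero morphism from
`ρ` to `R(φ₀, x)`. The target is simple because `Γ` acts freely off the origin (`eq_top_of_stable`),
so the two are isomorphic. If there is no such eigenvector, both operators are nilpotent, long paths
vanish in `ρ`, and `ρ` degenerates to `0 = R(φ₀, 0)`.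

Existence of a preprojective regular datum (`exists_preprojective`): if `ℂ²` splits, all simple
representations are characters and multiplication of numbers works. If `ℂ²` is simple, its
symplectic form pairs the intertwining maps of opposite arrows perfectly. For dual bases the
relation at `R(φ, x)` is the completeness identity contracted with `x`, which vanishes because the
form is alternating. -/

theorem dual_mem_coordRing (X : Set W) (l : Module.Dual ℂ W) :
    (fun x : X => l x) ∈ coordRing X :=
  Algebra.subset_adjoin ⟨l, rfl⟩

theorem const_mem_coordRing (X : Set W) (c : ℂ) : (fun _ : X => c) ∈ coordRing X :=
  Subalgebra.algebraMap_mem _ c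

theorem mul_mem_coordRing {X : Set W} {f g : X → ℂ} (hf : f ∈ coordRing X) (hg : g ∈ coordRing X) :
    (fun x => f x * g x) ∈ coordRing X :=
  mul_mem hf hg

theorem sum_mem_coordRing {X : Set W} {ι : Type*} (s : Finset ι) {f : ι → X → ℂ}
    (hf : ∀ i ∈ s, f i ∈ coordRing X) : (fun x => ∑ i ∈ s, f i x) ∈ coordRing X := by
  have := sum_mem hf
  convert this using 1
  ext x
  simp

theorem comp_mem_coordRing {X : Set W} {Y : Set W'} (r : X → Y)
    (hr : ∀ l : Module.Dual ℂ W', (fun x => l (r x)) ∈ coordRing X) {f : Y → ℂ}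
    (hf : f ∈ coordRing Y) : (fun x => f (r x)) ∈ coordRing X := by
  induction hf using Algebra.adjoin_induction with
  | mem f hf =>
    obtain ⟨l, rfl⟩ := hf
    exact hr l
  | algebraMap c => exact const_mem_coordRing X c
  | add f g _ _ hf hg => exact add_mem hf hg
  | mul f g _ _ hf hg => exact mul_mem hf hg

theorem exists_extension {X : Set W} {f : X → ℂ} (hf : f ∈ coordRing X) :
    ∃ F ∈ coordRing (Set.univ : Set W), ∀ x : X, F ⟨x, trivial⟩ = f x := by
  induction hf using Algebra.adjoin_induction with
  | mem f hf =>
    obtain ⟨l, rfl⟩ := hf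
    exact ⟨_, dual_mem_coordRing _ l, fun _ => rfl⟩
  | algebraMap c => exact ⟨_, const_mem_coordRing _ c, fun _ => rfl⟩
  | add f g _ _ hf hg =>
    obtain ⟨F, hF, hF'⟩ := hf
    obtain ⟨G, hG, hG'⟩ := hg
    exact ⟨_, add_mem hF hG, fun x => by simp [hF', hG']⟩
  | mul f g _ _ hf hg =>
    obtain ⟨F, hF, hF'⟩ := hf
    obtain ⟨G, hG, hG'⟩ := hg
    exact ⟨_, mul_mem hF hG, fun x => by simp [hF', hG']⟩

/-- Along a polynomial curve, a regular function is a polynomial in the parameter. -/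
theorem exists_polynomial_along_curve {F : ↥(Set.univ : Set W) → ℂ}
    (hF : F ∈ coordRing (Set.univ : Set W)) (N : ℕ) (w : ℕ → W) :
    ∃ p : Polynomial ℂ, ∀ t : ℂ, p.eval t = F ⟨∑ n ∈ Finset.range N, t ^ n • w n, trivial⟩ := by
  induction hF using Algebra.adjoin_induction with
  | mem f hf =>
    obtain ⟨l, rfl⟩ := hf
    refine ⟨∑ n ∈ Finset.range N, Polynomial.C (l (w n)) * Polynomial.X ^ n, fun t => ?_⟩
    simp only [Polynomial.eval_finsetSum, Polynomial.eval_mul, Polynomial.eval_C,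
      Polynomial.eval_pow, Polynomial.eval_X, map_sum, map_smul, smul_eq_mul]
    exact Finset.sum_congr rfl fun n _ => mul_comm _ _
  | algebraMap c => exact ⟨Polynomial.C c, fun t => by simp⟩
  | add f g _ _ hf hg =>
    obtain ⟨p, hp⟩ := hf
    obtain ⟨q, hq⟩ := hg
    exact ⟨p + q, fun t => by simp [hp, hq]⟩
  | mul f g _ _ hf hg =>
    obtain ⟨p, hp⟩ := hf
    obtain ⟨q, hq⟩ := hg
    exact ⟨p * q, fun t => by simp [hp, hq]⟩

/-- A regular function that is constant along a punctured polynomial curve takes the same value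
at its starting point. -/
theorem eq_of_const_along_curve {F : ↥(Set.univ : Set W) → ℂ}
    (hF : F ∈ coordRing (Set.univ : Set W)) (N : ℕ) (w : ℕ → W) (c : ℂ)
    (h : ∀ t : ℂ, t ≠ 0 → F ⟨∑ n ∈ Finset.range N, t ^ n • w n, trivial⟩ = c) :
    F ⟨∑ n ∈ Finset.range N, (0 : ℂ) ^ n • w n, trivial⟩ = c := by
  obtain ⟨p, hp⟩ := exists_polynomial_along_curve hF N w
  have hpc : p = Polynomial.C c := by
    refine Polynomial.eq_of_infinite_eval_eq _ _ (Set.Infinite.mono (s := {0}ᶜ) ?_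
      (Set.finite_singleton (0 : ℂ)).infinite_compl)
    intro t ht
    simpa [hp] using h t ht
  rw [← hp, hpc, Polynomial.eval_C]

theorem exists_mvPolynomial {n : ℕ} {f : ↥(Set.univ : Set (Fin n → ℂ)) → ℂ}
    (hf : f ∈ coordRing (Set.univ : Set (Fin n → ℂ))) :
    ∃ q : MvPolynomial (Fin n) ℂ, ∀ x, MvPolynomial.eval x q = f ⟨x, trivial⟩ := by
  induction hf using Algebra.adjoin_induction with
  | mem f hf =>
    obtain ⟨l, rfl⟩ := hf
    refine ⟨∑ i, MvPolynomial.C (l (Pi.single i 1)) * MvPolynomial.X i, fun x => ?_⟩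
    conv_rhs => rw [← LinearMap.sum_single_apply (φ := fun _ : Fin n => ℂ) (v := x)]
    simp only [map_sum, map_mul, MvPolynomial.eval_C, MvPolynomial.eval_X]
    refine Finset.sum_congr rfl fun i _ => ?_
    have : (Pi.single i (x i) : Fin n → ℂ) = x i • Pi.single i 1 := by
      rw [← Pi.single_smul]; simp
    simp [this, mul_comm]
  | algebraMap c => exact ⟨MvPolynomial.C c, fun t => by simp⟩
  | add f g _ _ hf hg =>
    obtain ⟨p, hp⟩ := hf
    obtain ⟨q, hq⟩ := hg
    exact ⟨p + q, fun t => by simp [hp, hq]⟩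
  | mul f g _ _ hf hg =>
    obtain ⟨p, hp⟩ := hf
    obtain ⟨q, hq⟩ := hg
    exact ⟨p * q, fun t => by simp [hp, hq]⟩

/-- Linear combinations of values of linear forms are enough to describe a linear form in `l (B x)`
for a bilinear map of two polynomial maps. -/
theorem bilinear_mem_coordRing {X : Set W} {A B C : Type} [AddCommGroup A] [Module ℂ A]
    [FiniteDimensional ℂ A] [AddCommGroup B] [Module ℂ B] [FiniteDimensional ℂ B] [AddCommGroup C]
    [Module ℂ C] (β : A →ₗ[ℂ] B →ₗ[ℂ] C) {f : X → A} {g : X → B}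
    (hf : ∀ l : Module.Dual ℂ A, (fun x => l (f x)) ∈ coordRing X)
    (hg : ∀ l : Module.Dual ℂ B, (fun x => l (g x)) ∈ coordRing X) (l : Module.Dual ℂ C) :
    (fun x => l (β (f x) (g x))) ∈ coordRing X := by
  let a := Module.finBasis ℂ A
  let b := Module.finBasis ℂ B
  have : (fun x => l (β (f x) (g x))) = fun x => ∑ i, ∑ j,
      (a.coord i (f x) * b.coord j (g x)) * l (β (a i) (b j)) := by
    ext x
    conv_lhs => rw [← a.sum_repr (f x), ← b.sum_repr (g x)]
    simp only [map_sum, map_smul, LinearMap.sum_apply, LinearMap.smul_apply, smul_eq_mul,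
      Module.Basis.coord_apply, Finset.mul_sum]
    rw [Finset.sum_comm]
    refine Finset.sum_congr rfl fun i _ => Finset.sum_congr rfl fun j _ => by ring
  rw [this]
  exact sum_mem_coordRing _ fun i _ => sum_mem_coordRing _ fun j _ =>
    mul_mem_coordRing (mul_mem_coordRing (hf _) (hg _)) (const_mem_coordRing _ _)

theorem apply_mem_coordRing {X : Set W} {A B : Type} [AddCommGroup A] [Module ℂ A]
    [FiniteDimensional ℂ A] [AddCommGroup B] [Module ℂ B] [FiniteDimensional ℂ B]
    {f : X → A →ₗ[ℂ] B} {g : X → A}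
    (hf : ∀ l : Module.Dual ℂ (A →ₗ[ℂ] B), (fun x => l (f x)) ∈ coordRing X)
    (hg : ∀ l : Module.Dual ℂ A, (fun x => l (g x)) ∈ coordRing X) (l : Module.Dual ℂ B) :
    (fun x => l (f x (g x))) ∈ coordRing X :=
  bilinear_mem_coordRing LinearMap.id hf hg l

end CoordRing

end ClebschGordan

namespace ClebschGordan

/-! ### Simple representations -/

section Simple

variable {G : Type} [Group G] {I : Type} (S : SimpleReps G I)

instance (i : I) : (S.rep i).IsIrreducible := S.simple i

instance (i : I) : Nontrivial (S.U i) := by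
  by_contra h
  rw [not_nontrivial_iff_subsingleton] at h
  exact bot_ne_top (α := Subrepresentation (S.rep i))
    (Subrepresentation.toSubmodule_injective (Subsingleton.elim _ _))

theorem SimpleReps.eq_smul_id (i : I) (T : S.U i →ₗ[ℂ] S.U i)
    (hT : ∀ g u, T (S.rep i g u) = S.rep i g (T u)) : ∃ c : ℂ, T = c • LinearMap.id := by
  let f : (S.rep i).IntertwiningMap (S.rep i) := ⟨T, fun g => LinearMap.ext (hT g)⟩
  obtain ⟨c, hc⟩ :=
    (Representation.IsIrreducible.algebraMap_intertwiningMap_bijective_of_isAlgClosed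
      (ρ := S.rep i)).2 f
  refine ⟨c, ?_⟩
  refine LinearMap.ext fun u => ?_
  exact congrArg (fun F : (S.rep i).IntertwiningMap (S.rep i) => F.toLinearMap _) hc.symm

theorem SimpleReps.eq_zero_of_ne {i j : I} (hij : i ≠ j) (T : S.U i →ₗ[ℂ] S.U j)
    (hT : ∀ g u, T (S.rep i g u) = S.rep j g (T u)) : T = 0 := by
  let f : (S.rep i).IntertwiningMap (S.rep j) := ⟨T, fun g => LinearMap.ext (hT g)⟩
  rcases Representation.IsIrreducible.bijective_or_eq_zero f with h | h
  · exact absurd (S.eq_of_equiv i j ⟨f.ofBijective h⟩) hij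
  · exact congrArg Representation.IntertwiningMap.toLinearMap h

theorem SimpleReps.injective_of_ne_zero {i j : I} (T : S.U i →ₗ[ℂ] S.U j)
    (hT : ∀ g u, T (S.rep i g u) = S.rep j g (T u)) (h0 : T ≠ 0) : Function.Injective T := by
  let f : (S.rep i).IntertwiningMap (S.rep j) := ⟨T, fun g => LinearMap.ext (hT g)⟩
  rcases Representation.IsIrreducible.injective_or_eq_zero f with h | h
  · exact h
  · exact absurd (congrArg Representation.IntertwiningMap.toLinearMap h) h0

@[simp] theorem SimpleReps.rep_inv_rep (i : I) (g : G) (u : S.U i) :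
    S.rep i g⁻¹ (S.rep i g u) = u := by
  rw [← Module.End.mul_apply, ← map_mul]; simp

@[simp] theorem SimpleReps.rep_rep_inv (i : I) (g : G) (u : S.U i) :
    S.rep i g (S.rep i g⁻¹ u) = u := by
  rw [← Module.End.mul_apply, ← map_mul]; simp

/-- The action of a group element on a simple representation, as a linear equivalence. -/
def SimpleReps.repEquiv (g : G) (i : I) : S.U i ≃ₗ[ℂ] S.U i :=
  LinearEquiv.ofLinearMap (S.rep i g) (S.rep i g⁻¹) (LinearMap.ext fun u => by simp)
    (LinearMap.ext fun u => by simp)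

@[simp] theorem SimpleReps.repEquiv_apply (g : G) (i : I) (u : S.U i) :
    S.repEquiv g i u = S.rep i g u := rfl

@[simp] theorem SimpleReps.repEquiv_symm_apply (g : G) (i : I) (u : S.U i) :
    (S.repEquiv g i).symm u = S.rep i g⁻¹ u := rfl

/-- The gauge transformation given by the action of a group element. -/
def groupGauge (g : G) : gaugeGroup S :=
  ⟨S.repEquiv g, LinearEquiv.ext fun u => by simp [S.rep_zero]⟩

/-- Equivariance of `φ` says precisely that `Γ` maps into its stabilizer. This is all that is ever
needed about the stabilizer. -/
theorem gaugeCG_groupGauge {φ : CGDatum S} (hφ : IsRegular S φ) (g : G) :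
    gaugeCG S (groupGauge S g) φ = φ := by
  funext i j
  refine LinearMap.ext fun u => LinearMap.ext fun v => ?_
  funext k s
  rw [gaugeCG_apply]
  simp [groupGauge, ← hφ.equivariant]

end Simple

/-! ### The comparison map and the preprojective relations -/

section Kleinian

variable {Γ : Subgroup (Matrix.SpecialLinearGroup (Fin 2) ℂ)} {I K : Type}
  (S : SimpleReps Γ I) (D : Decomposition S K)

/-- The comparison map as a bilinear map. -/
def comparisonBilin : CGDatum S →ₗ[ℂ] (Fin 2 → ℂ) →ₗ[ℂ] DoubleRep S D :=
  LinearMap.mk₂ ℂ (fun φ x => comparison S D (φ, x))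
    (fun φ ψ x => by funext i j a; refine LinearMap.ext fun u => ?_; simp [comparison_apply])
    (fun c φ x => by funext i j a; refine LinearMap.ext fun u => ?_; simp [comparison_apply])
    (fun φ x y => by funext i j a; refine LinearMap.ext fun u => ?_; simp [comparison_apply])
    (fun c φ x => by funext i j a; refine LinearMap.ext fun u => ?_; simp [comparison_apply])

theorem comparisonBilin_apply (φ : CGDatum S) (x : Fin 2 → ℂ) :
    comparisonBilin S D φ x = comparison S D (φ, x) := rfl

theorem comparison_eq_sum (φ : CGDatum S) (x : Fin 2 → ℂ) :
    comparison S D (φ, x) = ∑ n, x n • comparison S D (φ, Pi.single n 1) := by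
  have hx : x = ∑ n, x n • Pi.single n 1 := by
    ext m; simp [Finset.sum_apply, Pi.single_apply]
  conv_lhs => rw [hx, ← comparisonBilin_apply]
  simp only [map_sum, map_smul, comparisonBilin_apply]

theorem comparison_apply_eq_sum (φ : CGDatum S) (x : Fin 2 → ℂ) {i j : I} (a : Arrow S D i j)
    (u : S.U i) :
    comparison S D (φ, x) i j a u = ∑ n, x n • comparison S D (φ, Pi.single n 1) i j a u := by
  rw [comparison_eq_sum]; simp [Finset.sum_apply]

variable {S D} in
theorem comparison_equivariant {φ : CGDatum S} (hφ : IsRegular S φ) (g : Γ) (x : Fin 2 → ℂ)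
    {i j : I} (a : Arrow S D i j) (u : S.U i) :
    comparison S D (φ, g.1.1.mulVec x) i j a (S.rep i g u) =
      S.rep j g (comparison S D (φ, x) i j a u) := by
  simp only [comparison_apply, D.equivariant, hφ.equivariant]

/-- Simultaneous change of basis in a representation of the double quiver. -/
def conjRep (g : ∀ i, S.U i ≃ₗ[ℂ] S.U i) (ρ : DoubleRep S D) : DoubleRep S D :=
  fun i j a => (g j).toLinearMap ∘ₗ ρ i j a ∘ₗ (g i).symm.toLinearMap

theorem gaugeRep_eq_conjRep (g : gaugeGroup S) (ρ : DoubleRep S D) :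
    gaugeRep S D g ρ = conjRep S D g.1 ρ := rfl

theorem comparison_gaugePair (g : gaugeGroup S) (z : CGDatum S × (Fin 2 → ℂ)) :
    comparison S D (gaugePair S D g z) = gaugeRep S D g (comparison S D z) := by
  funext i j a
  refine LinearMap.ext fun u => ?_
  simp [comparison_apply, gaugePair, gaugeRep, gaugeCG_apply, gaugePlane]

theorem gaugePlane_groupGauge (g : Γ) (x : Fin 2 → ℂ) :
    gaugePlane S D (groupGauge S g) x = g.1.1.mulVec x := by
  apply D.iso.injective
  funext k
  rw [D.equivariant]
  simp [gaugePlane, groupGauge]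

theorem gaugePlane_gaugePlane_inv (g : gaugeGroup S) (x : Fin 2 → ℂ) :
    gaugePlane S D g (gaugePlane S D g⁻¹ x) = x := by
  apply D.iso.injective
  funext k
  simp only [gaugePlane, LinearEquiv.apply_symm_apply]
  exact (g.1 (D.p k)).apply_symm_apply _

section Relation

variable [Fintype I] [Fintype K] {S D} (Q : KleinianQuiver S D)

/-- The sign of an arrow of the double quiver. -/
def KleinianQuiver.sign {i j : I} (a : Arrow S D i j) : ℂ := if Q.pos a then 1 else -1

omit [Fintype I] [Fintype K] in
theorem KleinianQuiver.sign_ne_zero {i j : I} (a : Arrow S D i j) : Q.sign a ≠ 0 := by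
  unfold KleinianQuiver.sign; split <;> simp

/-- The value of the preprojective relation at a vertex. -/
def relation (ρ : DoubleRep S D) (v : I) : S.U v →ₗ[ℂ] S.U v :=
  ∑ j : I, ∑ b : Arrow S D v j, Q.sign b • (ρ j v (Q.star b) ∘ₗ ρ v j b)

/-- The substitution `a = b*` turns the sum over arrows with head `v` into a sum over arrows `b`
with tail `v`. The relation becomes a single signed sum of the loops `b* b`. -/
theorem mem_preprojectiveRep_iff {ρ : DoubleRep S D} :
    ρ ∈ preprojectiveRep S D Q ↔ ∀ v, relation Q ρ v = 0 := by
  refine forall_congr' fun v => ?_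
  have h1 : (∑ i : I, ∑ a : Arrow S D i v, if Q.pos a then ρ i v a ∘ₗ ρ v i (Q.star a) else 0) =
      ∑ j : I, ∑ b : Arrow S D v j, if Q.pos b then 0 else ρ j v (Q.star b) ∘ₗ ρ v j b := by
    refine Finset.sum_congr rfl fun j _ => ?_
    refine Finset.sum_bij' (fun a _ => Q.star a) (fun b _ => Q.star b) (by simp) (by simp)
      (fun a _ => Q.star_star a) (fun b _ => Q.star_star b) fun a _ => ?_
    rw [Q.pos_star, Q.star_star]
    cases Q.pos a <;> simp
  rw [h1, eq_comm, ← sub_eq_zero, ← Finset.sum_sub_distrib]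
  simp only [← Finset.sum_sub_distrib]
  rw [relation, iff_iff_eq]
  congr 1
  refine Finset.sum_congr rfl fun j _ => Finset.sum_congr rfl fun b _ => ?_
  unfold KleinianQuiver.sign
  cases Q.pos b <;> (refine LinearMap.ext fun u => ?_; simp)

theorem relation_apply (ρ : DoubleRep S D) (v : I) (u : S.U v) :
    relation Q ρ v u = ∑ j : I, ∑ b : Arrow S D v j, Q.sign b • ρ j v (Q.star b) (ρ v j b u) := by
  simp [relation, LinearMap.sum_apply]

theorem relation_conjRep (g : ∀ i, S.U i ≃ₗ[ℂ] S.U i) (ρ : DoubleRep S D) (v : I) (u : S.U v) :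
    relation Q (conjRep S D g ρ) v u = g v (relation Q ρ v ((g v).symm u)) := by
  simp [relation_apply, conjRep, map_sum]

theorem conjRep_mem_preprojectiveRep (g : ∀ i, S.U i ≃ₗ[ℂ] S.U i) {ρ : DoubleRep S D}
    (hρ : ρ ∈ preprojectiveRep S D Q) : conjRep S D g ρ ∈ preprojectiveRep S D Q := by
  rw [mem_preprojectiveRep_iff] at hρ ⊢
  intro v
  refine LinearMap.ext fun u => ?_
  rw [relation_conjRep, hρ]
  simp

/-- The linear dependence of the arrow maps of `R(φ, x)` on `φ`. -/
def arrowLinear (x : Fin 2 → ℂ) {i j : I} (a : Arrow S D i j) :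
    CGDatum S →ₗ[ℂ] (S.U i →ₗ[ℂ] S.U j) where
  toFun φ := comparison S D (φ, x) i j a
  map_add' φ ψ := by rw [← comparisonBilin_apply, map_add]; rfl
  map_smul' c φ := by rw [← comparisonBilin_apply, map_smul]; rfl

theorem relation_mem_coordRing {W : Type} [AddCommGroup W] [Module ℂ W] {X : Set W}
    {σ : X → DoubleRep S D} (hσ : ∀ (i j : I) (a : Arrow S D i j)
      (l : Module.Dual ℂ (S.U i →ₗ[ℂ] S.U j)), (fun x => l (σ x i j a)) ∈ coordRing X)
    (v : I) (u : S.U v) (l : Module.Dual ℂ (S.U v)) :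
    (fun x => l (relation Q (σ x) v u)) ∈ coordRing X := by
  simp only [relation_apply, map_sum, map_smul, smul_eq_mul]
  refine sum_mem_coordRing _ fun j _ => sum_mem_coordRing _ fun b _ =>
    mul_mem_coordRing (const_mem_coordRing _ _) ?_
  exact apply_mem_coordRing (hσ j v (Q.star b))
    (fun l => hσ v j b (l ∘ₗ LinearMap.applyₗ u)) l

omit [Fintype I] [Fintype K] in
theorem comparison_mem_coordRing (x : Fin 2 → ℂ) {i j : I} (a : Arrow S D i j)
    (l : Module.Dual ℂ (S.U i →ₗ[ℂ] S.U j)) :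
    (fun φ : (Set.univ : Set (CGDatum S)) => l (comparison S D (φ.1, x) i j a)) ∈
      coordRing (Set.univ : Set (CGDatum S)) := by
  have h := dual_mem_coordRing (Set.univ : Set (CGDatum S)) (l ∘ₗ arrowLinear x a)
  exact h

theorem relation_comparison_mem_coordRing (x : Fin 2 → ℂ) (v : I) (u : S.U v)
    (l : Module.Dual ℂ (S.U v)) :
    (fun φ : (Set.univ : Set (CGDatum S)) => l (relation Q (comparison S D (φ.1, x)) v u)) ∈
      coordRing (Set.univ : Set (CGDatum S)) :=
  relation_mem_coordRing Q (σ := fun φ : (Set.univ : Set (CGDatum S)) => comparison S D (φ.1, x))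
    (fun _ _ a l => comparison_mem_coordRing x a l) v u l

/-- The preprojective relations pass from `φ₀` to the whole Clebsch-Gordan variety. -/
theorem comparison_mem_preprojectiveRep {φ₀ : CGDatum S}
    (h : ∀ x, comparison S D (φ₀, x) ∈ preprojectiveRep S D Q) :
    ∀ z ∈ cgPlane S φ₀, comparison S D z ∈ preprojectiveRep S D Q := by
  rintro ⟨φ, x⟩ ⟨hφ, -⟩
  rw [mem_preprojectiveRep_iff]
  intro v
  refine LinearMap.ext fun u => ?_
  rw [LinearMap.zero_apply]
  rw [← Module.forall_dual_apply_eq_zero_iff ℂ]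
  intro l
  refine hφ _ (relation_comparison_mem_coordRing Q x v u l) ?_
  rintro _ ⟨g, rfl⟩
  -- On the orbit, `R(g φ₀, x) = g R(φ₀, g⁻¹ x)`, and the relations are stable under change of
  -- basis.
  have hmem : comparison S D (gaugeCG S g φ₀, x) ∈ preprojectiveRep S D Q := by
    have := conjRep_mem_preprojectiveRep Q g.1 (h (gaugePlane S D g⁻¹ x))
    rwa [← gaugeRep_eq_conjRep, ← comparison_gaugePair, gaugePair, gaugePlane_gaugePlane_inv]
      at this
  rw [mem_preprojectiveRep_iff] at hmem
  simp [hmem]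

end Relation

end Kleinian

end ClebschGordan

namespace ClebschGordan

/-! ### The arrows out of a vertex decompose `U i ⊗ ℂ²` -/

section Out

variable {Γ : Subgroup (Matrix.SpecialLinearGroup (Fin 2) ℂ)} {I K : Type} [Fintype K]
  {S : SimpleReps Γ I} {D : Decomposition S K} {φ : CGDatum S}

open Classical in
-- A pair `w` is a tensor in `U i ⊗ ℂ²`, which is the sum over `k` of the `U i ⊗ U (p k)`. On each
-- summand `φ` is bijective, and the copies of the `U j` that appear are the heads of the arrows.
theorem outMap_bijective (hφ : IsRegular S φ) (i : I) : Function.Bijective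
    (fun (w : Fin 2 → S.U i) (j : I) (a : Arrow S D i j) =>
      ∑ n, comparison S D (φ, Pi.single n 1) i j a (w n)) := by
  let e : (Fin 2 → S.U i) ≃ₗ[ℂ] ∀ k : K, S.U i ⊗[ℂ] S.U (D.p k) :=
    (TensorProduct.piScalarRight ℂ ℂ (S.U i) (Fin 2)).symm ≪≫ₗ
      TensorProduct.congr (LinearEquiv.refl ℂ _) D.iso ≪≫ₗ TensorProduct.piRight ℂ ℂ _ _
  have he : ∀ w k, e w k = ∑ n, w n ⊗ₜ[ℂ] D.iso (Pi.single n 1) k := by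
    intro w k
    have hw : w = ∑ n, Pi.single n (w n) := (Finset.univ_sum_single w).symm
    conv_lhs => rw [hw]
    simp only [map_sum, Finset.sum_apply]
    refine Finset.sum_congr rfl fun n _ => ?_
    simp [e]
  let f : (∀ k : K, S.U i ⊗[ℂ] S.U (D.p k)) → ∀ k : K, ∀ j, Fin (S.cg i (D.p k) j) → S.U j :=
    fun t k => TensorProduct.lift (φ i (D.p k)) (t k)
  have hf : Function.Bijective f :=
    ⟨fun t t' h => funext fun k => (hφ.bijective i (D.p k)).1 (congrFun h k), fun y =>
      ⟨fun k => ((hφ.bijective i (D.p k)).2 (y k)).choose,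
        funext fun k => ((hφ.bijective i (D.p k)).2 (y k)).choose_spec⟩⟩
  let r : (∀ k : K, ∀ j, Fin (S.cg i (D.p k) j) → S.U j) → ∀ j, Arrow S D i j → S.U j :=
    fun y j a => y a.1 j a.2
  have hr : Function.Bijective r :=
    ⟨fun y y' h => funext fun k => funext fun j => funext fun s =>
      congrFun (congrFun h j) ⟨k, s⟩, fun y => ⟨fun k j s => y j ⟨k, s⟩, rfl⟩⟩
  have := hr.comp (hf.comp e.bijective)
  convert this using 1
  funext w j a
  simp [r, f, he, comparison_apply]

/-- The decomposition of `U i ⊗ ℂ²`, whose elements are written as pairs `w` of vectors of `U i`,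
into the simple representations at the heads of the arrows that start at `i`. -/
def outEquiv (hφ : IsRegular S φ) (i : I) :
    (Fin 2 → S.U i) ≃ₗ[ℂ] ∀ j : I, Arrow S D i j → S.U j :=
  LinearEquiv.ofBijective
    { toFun := fun w j a => ∑ n, comparison S D (φ, Pi.single n 1) i j a (w n)
      map_add' := fun w w' => by
        funext j a; simp [Finset.sum_add_distrib]
      map_smul' := fun c w => by
        funext j a; simp } (outMap_bijective hφ i)

theorem outEquiv_apply (hφ : IsRegular S φ) {i j : I} (w : Fin 2 → S.U i) (a : Arrow S D i j) :
    outEquiv hφ i w j a = ∑ n, comparison S D (φ, Pi.single n 1) i j a (w n) := rfl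

theorem outEquiv_tmul (hφ : IsRegular S φ) {i j : I} (x : Fin 2 → ℂ) (u : S.U i)
    (a : Arrow S D i j) :
    outEquiv hφ i (fun n => x n • u) j a = comparison S D (φ, x) i j a u := by
  rw [outEquiv_apply, comparison_apply_eq_sum]; simp

theorem outEquiv_symm_comparison (hφ : IsRegular S φ) {i : I} (x : Fin 2 → ℂ) (u : S.U i) :
    (outEquiv hφ i).symm (fun j (a : Arrow S D i j) => comparison S D (φ, x) i j a u) =
      fun n => x n • u := by
  rw [LinearEquiv.symm_apply_eq]
  funext j a
  rw [outEquiv_tmul]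

theorem outEquiv_symm_spec (hφ : IsRegular S φ) {i j : I} (y : ∀ j : I, Arrow S D i j → S.U j)
    (a : Arrow S D i j) :
    ∑ n, comparison S D (φ, Pi.single n 1) i j a ((outEquiv hφ i).symm y n) = y j a := by
  rw [← outEquiv_apply hφ, LinearEquiv.apply_symm_apply]

end Out

/-! ### Functions given by linear combinations of paths -/

section Paths

variable {Γ : Subgroup (Matrix.SpecialLinearGroup (Fin 2) ℂ)} {I K : Type}
  {S : SimpleReps Γ I} {D : Decomposition S K}

/-- The linear combinations of paths from `i` to `j`, as functions on the representations of the
double quiver. -/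
inductive PathFun (S : SimpleReps Γ I) (D : Decomposition S K) (j : I) :
    ∀ i : I, (DoubleRep S D → (S.U i →ₗ[ℂ] S.U j)) → Prop
  | zero (i : I) : PathFun S D j i fun _ => 0
  | id : PathFun S D j j fun _ => LinearMap.id
  | add {i : I} {F F' : DoubleRep S D → (S.U i →ₗ[ℂ] S.U j)} :
    PathFun S D j i F → PathFun S D j i F' → PathFun S D j i fun ρ => F ρ + F' ρ
  | smul {i : I} (c : ℂ) {F : DoubleRep S D → (S.U i →ₗ[ℂ] S.U j)} :
    PathFun S D j i F → PathFun S D j i fun ρ => c • F ρ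
  | arrow {i l : I} (a : Arrow S D i l) {F : DoubleRep S D → (S.U l →ₗ[ℂ] S.U j)} :
    PathFun S D j l F → PathFun S D j i fun ρ => F ρ ∘ₗ ρ i l a

theorem PathFun.sum {i j : I} {ι : Type*} (s : Finset ι)
    (F : ι → DoubleRep S D → (S.U i →ₗ[ℂ] S.U j)) (hF : ∀ a ∈ s, PathFun S D j i (F a)) :
    PathFun S D j i fun ρ => ∑ a ∈ s, F a ρ := by
  classical
  induction s using Finset.induction_on with
  | empty => simpa using PathFun.zero i
  | insert a s ha ih =>
    simp only [Finset.sum_insert ha]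
    exact (hF a (by simp)).add (ih fun b hb => hF b (by simp [hb]))

/-- The changes of basis at inner vertices cancel. For closed paths at the trivial vertex, where the
gauge group acts by `1`, this is invariance. -/
theorem PathFun.conjRep {i j : I} {F : DoubleRep S D → (S.U i →ₗ[ℂ] S.U j)}
    (hF : PathFun S D j i F) (g : ∀ i, S.U i ≃ₗ[ℂ] S.U i) (ρ : DoubleRep S D) (u : S.U i) :
    F (ClebschGordan.conjRep S D g ρ) u = g j (F ρ ((g i).symm u)) := by
  induction hF with
  | zero => simp
  | id => simp
  | add _ _ h1 h2 => simp [h1, h2]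
  | smul c _ h => simp [h]
  | arrow a _ h => simp [h, ClebschGordan.conjRep]

theorem PathFun.mem_coordRing [Fintype I] [Fintype K] {i j : I}
    {F : DoubleRep S D → (S.U i →ₗ[ℂ] S.U j)} (hF : PathFun S D j i F) (X : Set (DoubleRep S D))
    (l : Module.Dual ℂ (S.U i →ₗ[ℂ] S.U j)) : (fun ρ : X => l (F ρ)) ∈ coordRing X := by
  induction hF with
  | zero => simpa using const_mem_coordRing X 0
  | id => exact const_mem_coordRing X _
  | add _ _ h1 h2 =>
    simp only [map_add]
    exact add_mem (h1 l) (h2 l)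
  | smul c _ h => simpa using mul_mem_coordRing (const_mem_coordRing X c) (h l)
  | @arrow i m a F _ h =>
    have h2 : ∀ l' : Module.Dual ℂ (S.U i →ₗ[ℂ] S.U m),
        (fun ρ : X => l' (ρ.1 i m a)) ∈ coordRing X := fun l' => by
      have := dual_mem_coordRing X (l' ∘ₗ
        LinearMap.proj (φ := fun _ : Arrow S D i m => S.U i →ₗ[ℂ] S.U m) a ∘ₗ
        LinearMap.proj (φ := fun m : I => Arrow S D i m → (S.U i →ₗ[ℂ] S.U m)) m ∘ₗ
        LinearMap.proj (φ := fun i : I => ∀ m : I, Arrow S D i m → (S.U i →ₗ[ℂ] S.U m)) i)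
      exact this
    exact bilinear_mem_coordRing (LinearMap.llcomp ℂ (S.U i) (S.U m) (S.U j)) h h2 l

/-- A family of subspaces that is stable under the arrows is stable under the paths. -/
theorem PathFun.mem_of_stable {ρ : DoubleRep S D} (A : ∀ i, Submodule ℂ (S.U i))
    (hA : ∀ i j (a : Arrow S D i j), ∀ u ∈ A i, ρ i j a u ∈ A j) {i j : I}
    {F : DoubleRep S D → (S.U i →ₗ[ℂ] S.U j)} (hF : PathFun S D j i F) {u : S.U i}
    (hu : u ∈ A i) : F ρ u ∈ A j := by
  induction hF with
  | zero => simp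
  | id => exact hu
  | add _ _ h1 h2 => exact add_mem (h1 hu) (h2 hu)
  | smul c _ h => exact Submodule.smul_mem _ _ (h hu)
  | arrow a _ h => exact h (hA _ _ a _ hu)

/-- The average of a polynomial map `ℂ² → Hom (U i, U j)`, here `x ↦ q(x) B`, is a linear
combination of paths in `R(φ, x)`. -/
theorem exists_pathFun_average [Fintype I] [Fintype K] [Fintype Γ] {φ : CGDatum S}
    (hφ : IsRegular S φ) (q : MvPolynomial (Fin 2) ℂ) (j : I) : ∀ (i : I) (B : S.U i →ₗ[ℂ] S.U j),
    ∃ F, PathFun S D j i F ∧ ∀ x u, F (comparison S D (φ, x)) u =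
      ∑ g : Γ, MvPolynomial.eval (g⁻¹.1.1.mulVec x) q • S.rep j g (B (S.rep i g⁻¹ u)) := by
  classical
  induction q using MvPolynomial.induction_on with
  | C c =>
    intro i B
    -- For constant `q` the average is equivariant. By Schur it is a multiple of the trivial path,
    -- or zero if `i ≠ j`.
    let T : S.U i →ₗ[ℂ] S.U j := ∑ g : Γ, c • (S.rep j g ∘ₗ B ∘ₗ S.rep i g⁻¹)
    have hT : ∀ g u, T (S.rep i g u) = S.rep j g (T u) := by
      intro g u
      simp only [T, LinearMap.sum_apply, map_sum]
      refine Fintype.sum_equiv (Equiv.mulLeft g⁻¹) _ _ fun h => ?_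
      simp only [LinearMap.smul_apply, LinearMap.comp_apply, map_smul, Equiv.coe_mulLeft]
      rw [← Module.End.mul_apply (S.rep i h⁻¹), ← Module.End.mul_apply (S.rep j g), ← map_mul,
        ← map_mul]
      simp
    have hTu : ∀ u, T u = ∑ g : Γ, c • S.rep j g (B (S.rep i g⁻¹ u)) := fun u => by
      simp [T, LinearMap.sum_apply]
    by_cases hij : i = j
    · subst hij
      obtain ⟨b, hb⟩ := S.eq_smul_id i T hT
      refine ⟨_, PathFun.id.smul b, fun x u => ?_⟩
      rw [← hb, hTu]
      simp
    · refine ⟨_, PathFun.zero i, fun x u => ?_⟩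
      rw [← S.eq_zero_of_ne hij T hT, hTu]
      simp
  | add p q hp hq =>
    intro i B
    obtain ⟨F, hF, hF'⟩ := hp i B
    obtain ⟨F', hG, hG'⟩ := hq i B
    exact ⟨_, hF.add hG, fun x u => by
      simp [hF', hG', add_smul, Finset.sum_add_distrib]⟩
  | mul_X q n hq =>
    intro i B
    -- The `n`-th coordinate of the inverse of `outEquiv` on the summand of the arrow `a`. By `hι`
    -- these maps rebuild `x n • u` from the arrows of `R(φ, x)`. The factor `X n` thus becomes a
    -- sum over first arrows `a`, followed by the paths that the induction hypothesis gives for `B ∘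
    -- ι l a`.
    let ι : ∀ (l : I) (a : Arrow S D i l), S.U l →ₗ[ℂ] S.U i := fun l a =>
      LinearMap.proj n ∘ₗ (outEquiv hφ i).symm.toLinearMap ∘ₗ
        LinearMap.single ℂ (fun l => Arrow S D i l → S.U l) l ∘ₗ
          LinearMap.single ℂ (fun _ : Arrow S D i l => S.U l) a
    have hι : ∀ x u, ∑ l, ∑ a : Arrow S D i l, ι l a (comparison S D (φ, x) i l a u) =
        x n • u := by
      intro x u
      have h := congrFun (outEquiv_symm_comparison (D := D) hφ x u) n
      rw [← h, ← Finset.univ_sum_single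
        (fun l (a : Arrow S D i l) => comparison S D (φ, x) i l a u)]
      simp only [map_sum, Finset.sum_apply]
      refine Finset.sum_congr rfl fun l _ => ?_
      conv_rhs => rw [← Finset.univ_sum_single
        (fun a : Arrow S D i l => comparison S D (φ, x) i l a u)]
      rw [← LinearMap.single_apply ℂ]
      simp only [map_sum, Finset.sum_apply]
      rfl
    choose F hF hF' using fun (l : I) (a : Arrow S D i l) => hq l (B ∘ₗ ι l a)
    refine ⟨_, PathFun.sum Finset.univ _ fun l _ => PathFun.sum Finset.univ _ fun a _ =>
      (hF l a).arrow a, fun x u => ?_⟩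
    simp only [LinearMap.sum_apply, LinearMap.comp_apply, hF']
    simp_rw [Finset.sum_comm (s := Finset.univ (α := Arrow S D i _))]
    rw [Finset.sum_comm]
    refine Finset.sum_congr rfl fun g _ => ?_
    simp only [← Finset.smul_sum, ← map_sum, ← comparison_equivariant hφ]
    rw [hι]
    simp [mul_smul]

end Paths

end ClebschGordan

namespace ClebschGordan

/-! ### Free orbits -/

/-- A fixed vector and determinant `1` force trace `2`, so `(g - 1)² = 0` by Cayley–Hamilton and `g
^ m = 1 + m (g - 1)`. In characteristic zero finite order then gives `g = 1`. Hence `Γ` acts freely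
off the origin. -/
theorem eq_one_of_mulVec_eq {g : Matrix.SpecialLinearGroup (Fin 2) ℂ} (hg : IsOfFinOrder g)
    {x : Fin 2 → ℂ} (hx : x ≠ 0) (h : g.1.mulVec x = x) : g = 1 := by
  have hdet : (g.1 - 1).det = 0 := by
    rw [← Matrix.exists_mulVec_eq_zero_iff]
    exact ⟨x, hx, by rw [Matrix.sub_mulVec, h, Matrix.one_mulVec, sub_self]⟩
  have hdet1 := g.2
  rw [Matrix.det_fin_two] at hdet hdet1
  simp only [Matrix.sub_apply, Matrix.one_apply, Fin.isValue, if_true, zero_ne_one, one_ne_zero,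
    if_false, sub_zero] at hdet
  have htr : g.1 0 0 + g.1 1 1 = 2 := by linear_combination hdet1 - hdet
  have hsq : (g.1 - 1) * (g.1 - 1) = 0 := by
    ext a b
    fin_cases a <;> fin_cases b <;>
      simp only [Matrix.mul_apply, Fin.sum_univ_two, Matrix.sub_apply, Matrix.one_apply,
        Fin.isValue, Fin.zero_eta, Fin.mk_one, if_true, zero_ne_one, one_ne_zero, if_false,
        sub_zero, Matrix.zero_apply]
    · linear_combination g.1 0 0 * htr - hdet1
    · linear_combination g.1 0 1 * htr
    · linear_combination g.1 1 0 * htr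
    · linear_combination g.1 1 1 * htr - hdet1
  have hpow : ∀ m : ℕ, g.1 ^ m = 1 + (m : ℂ) • (g.1 - 1) := by
    intro m
    induction m with
    | zero => simp
    | succ m ih =>
      have : g.1 = 1 + (g.1 - 1) := by abel
      rw [pow_succ, ih]
      nth_rw 2 [this]
      rw [mul_add, add_mul, add_mul, Matrix.smul_mul, Matrix.smul_mul, hsq]
      simp only [mul_one, one_mul, smul_zero, add_zero, Nat.cast_add, Nat.cast_one, add_smul,
        one_smul]
      abel
  obtain ⟨m, hm, hgm⟩ := isOfFinOrder_iff_pow_eq_one.1 hg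
  have h1 : g.1 ^ m = 1 := by
    rw [← Matrix.SpecialLinearGroup.coe_pow, hgm, Matrix.SpecialLinearGroup.coe_one]
  rw [hpow m, add_eq_left, smul_eq_zero, sub_eq_zero] at h1
  rcases h1 with h1 | h1
  · exact absurd (Nat.cast_eq_zero.1 h1) hm.ne'
  · exact Subtype.ext h1

theorem exists_mvPolynomial_separating {n : ℕ} {ι : Type*} (s : Finset ι) (x : Fin n → ℂ)
    (y : ι → Fin n → ℂ) (h : ∀ i ∈ s, y i ≠ x) : ∃ q : MvPolynomial (Fin n) ℂ,
    MvPolynomial.eval x q = 1 ∧ ∀ i ∈ s, MvPolynomial.eval (y i) q = 0 := by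
  classical
  induction s using Finset.induction_on with
  | empty => exact ⟨1, by simp, by simp⟩
  | insert a s ha ih =>
    obtain ⟨q, hq1, hq0⟩ := ih fun i hi => h i (by simp [hi])
    obtain ⟨m, hm⟩ := Function.ne_iff.1 (h a (by simp))
    have hm' : x m - y a m ≠ 0 := sub_ne_zero.2 hm.symm
    refine ⟨q * ((MvPolynomial.X m - MvPolynomial.C (y a m)) *
      MvPolynomial.C (x m - y a m)⁻¹), by simp [hq1, hm'], fun i hi => ?_⟩
    rcases Finset.mem_insert.1 hi with rfl | hi
    · simp
    · simp [hq0 i hi]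

/-! ### Extension of invariant polynomials, and simplicity of `R(φ, x)` -/

section Kleinian

variable {Γ : Subgroup (Matrix.SpecialLinearGroup (Fin 2) ℂ)} [Finite Γ] {I K : Type} [Fintype I]
  [Fintype K] {S : SimpleReps Γ I} {D : Decomposition S K} {φ : CGDatum S}

/-- Every polynomial that is invariant under the stabilizer of `φ` is the restriction of an
invariant function on the representations of the preprojective algebra. -/
theorem exists_invariant_extension (hφ : IsRegular S φ) (Q : KleinianQuiver S D)
    {q : MvPolynomial (Fin 2) ℂ} (hq : q ∈ stabInvariants S D φ) :
    ∃ f ∈ invariantRing (gaugeRep S D) (preprojectiveRep S D Q), ∀ (x : Fin 2 → ℂ)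
      (hx : comparison S D (φ, x) ∈ preprojectiveRep S D Q),
      f ⟨_, hx⟩ = MvPolynomial.eval x q := by
  classical
  have := Fintype.ofFinite Γ
  -- With `B = |Γ|⁻¹ • id` on the trivial representation the average of an invariant `q` is `q`
  -- times the identity.
  obtain ⟨F, hF, hF'⟩ := exists_pathFun_average (D := D) hφ q S.zero S.zero
    ((Fintype.card Γ : ℂ)⁻¹ • LinearMap.id)
  let c : Fin (S.dim S.zero) := ⟨0, by simp [S.dim_zero]⟩
  let l : Module.Dual ℂ (S.U S.zero →ₗ[ℂ] S.U S.zero) :=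
    LinearMap.proj c ∘ₗ LinearMap.applyₗ S.one
  refine ⟨fun ρ => l (F ρ), ⟨hF.mem_coordRing _ l, ?_⟩, fun x hx => ?_⟩
  · rintro g ⟨ρ, hρ⟩ ⟨_, hρ'⟩ rfl
    have hg : g.1 S.zero = 1 := g.2
    have := hF.conjRep g.1 ρ S.one
    rw [hg] at this
    exact congrFun this c
  · have h1 : ∀ g : Γ, MvPolynomial.eval (g.1.1.mulVec x) q = MvPolynomial.eval x q := by
      intro g
      rw [← gaugePlane_groupGauge S D]
      exact hq _ (gaugeCG_groupGauge S hφ g) x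
    change F (comparison S D (φ, x)) S.one c = _
    rw [hF']
    have hc : (Fintype.card Γ : ℂ) ≠ 0 := Nat.cast_ne_zero.2 Fintype.card_ne_zero
    simp only [h1]
    simp [S.rep_zero, SimpleReps.one]
    field_simp

/-- The representation `R(φ, x)` is simple for `x ≠ 0`. -/
theorem eq_top_of_stable (hφ : IsRegular S φ) {x : Fin 2 → ℂ} (hx : x ≠ 0)
    (A : ∀ i, Submodule ℂ (S.U i))
    (hA : ∀ i j (a : Arrow S D i j), ∀ u ∈ A i, comparison S D (φ, x) i j a u ∈ A j)
    {i : I} (hi : A i ≠ ⊥) (j : I) : A j = ⊤ := by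
  classical
  have := Fintype.ofFinite Γ
  obtain ⟨u, hu, hu0⟩ := Submodule.exists_mem_ne_zero_of_ne_bot hi
  obtain ⟨l, hl⟩ : ∃ l : Module.Dual ℂ (S.U i), l u ≠ 0 := by
    by_contra! h
    exact hu0 ((Module.forall_dual_apply_eq_zero_iff ℂ u).1 h)
  -- The orbit of `x` is free, so some `q` is `1` at `x` and `0` at its other points. The average of
  -- `q B` at `x` is then `B` alone, so every linear map `U i → U j` is a combination of paths, in
  -- particular one that takes `u` to `w`.
  obtain ⟨q, hq1, hq0⟩ := exists_mvPolynomial_separating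
    (Finset.univ.erase (1 : Γ)) x (fun g => g⁻¹.1.1.mulVec x) fun g hg h => by
      have hfin : IsOfFinOrder g⁻¹ := isOfFinOrder_of_finite _
      have h1 := eq_one_of_mulVec_eq (Γ.subtype.isOfFinOrder hfin) hx h
      have h2 : g⁻¹ = 1 := Subtype.ext h1
      exact (Finset.mem_erase.1 hg).1 (inv_eq_one.1 h2)
  rw [eq_top_iff]
  intro w _
  obtain ⟨F, hF, hF'⟩ := exists_pathFun_average (D := D) hφ q j i ((l u)⁻¹ • l.smulRight w)
  have := hF.mem_of_stable A hA hu
  rw [hF', Finset.sum_eq_single_of_mem 1 (Finset.mem_univ _) fun g _ hg => by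
    rw [hq0 g (by simp [hg]), zero_smul]] at this
  simpa [hq1, hl] using this

end Kleinian

end ClebschGordan

namespace ClebschGordan

/-! ### Commuting endomorphisms -/

section Commuting

variable {V : Type*} [AddCommGroup V] [Module ℂ V] [FiniteDimensional ℂ V]

/-- The generalized eigenspaces span `V` over `ℂ`, so only the one for `0` is left. -/
theorem isNilpotent_of_forall_hasEigenvalue {f : Module.End ℂ V}
    (h : ∀ μ, f.HasEigenvalue μ → μ = 0) : IsNilpotent f := by
  have htop : f.maxGenEigenspace 0 = ⊤ := by
    rw [eq_top_iff, ← Module.End.iSup_maxGenEigenspace_eq_top f]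
    refine iSup_le fun μ => ?_
    by_cases hμ : f.HasEigenvalue μ
    · rw [h μ hμ]
    · have : f.maxGenEigenspace μ = ⊥ := by
        by_contra hne
        rw [Module.End.maxGenEigenspace_eq_genEigenspace_finrank] at hne
        exact hμ (Module.End.hasEigenvalue_of_hasGenEigenvalue hne)
      rw [this]
      exact bot_le
  rw [Module.End.maxGenEigenspace_eq_genEigenspace_finrank] at htop
  refine ⟨Module.finrank ℂ V, LinearMap.ext fun v => ?_⟩
  have hv : v ∈ f.genEigenspace 0 (Module.finrank ℂ V : ℕ) := htop ▸ Submodule.mem_top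
  simpa [Module.End.mem_genEigenspace_nat] using hv

theorem exists_joint_eigenvector {f g : Module.End ℂ V} (hfg : Commute f g) {μ : ℂ}
    (hμ : f.HasEigenvalue μ) : ∃ (ν : ℂ) (v : V), v ≠ 0 ∧ f v = μ • v ∧ g v = ν • v := by
  let E := f.eigenspace μ
  have hmaps : ∀ v ∈ E, g v ∈ E := Module.End.mapsTo_genEigenspace_of_comm hfg μ 1
  have hE : Nontrivial E := (Submodule.nontrivial_iff_ne_bot).2 hμ
  obtain ⟨ν, hν⟩ := Module.End.exists_eigenvalue (g.restrict hmaps)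
  obtain ⟨v, hv⟩ := hν.exists_hasEigenvector
  refine ⟨ν, v, fun h => hv.2 (Subtype.ext h), Module.End.mem_eigenspace_iff.1 v.2, ?_⟩
  exact congrArg Subtype.val hv.apply_eq_smul

/-- This is the dichotomy for a finite-dimensional `ℂ[X, Y]`-module: either its support has a point
off the origin, or it is supported at the origin. -/
theorem joint_eigenvector_or_isNilpotent {X : Fin 2 → Module.End ℂ V} (h : Commute (X 0) (X 1)) :
    (∃ (x : Fin 2 → ℂ) (v : V), x ≠ 0 ∧ v ≠ 0 ∧ ∀ n, X n v = x n • v) ∨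
      ∀ n, IsNilpotent (X n) := by
  by_cases h0 : ∃ μ, (X 0).HasEigenvalue μ ∧ μ ≠ 0
  · obtain ⟨μ, hμ, hμ0⟩ := h0
    obtain ⟨ν, v, hv, h1, h2⟩ := exists_joint_eigenvector h hμ
    exact .inl ⟨![μ, ν], v, fun h => hμ0 (congrFun h 0), hv, by
      simpa [Fin.forall_fin_two] using ⟨h1, h2⟩⟩
  by_cases h1 : ∃ μ, (X 1).HasEigenvalue μ ∧ μ ≠ 0
  · obtain ⟨μ, hμ, hμ0⟩ := h1
    obtain ⟨ν, v, hv, h1, h2⟩ := exists_joint_eigenvector h.symm hμ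
    exact .inl ⟨![ν, μ], v, fun h => hμ0 (congrFun h 1), hv, by
      simpa [Fin.forall_fin_two] using ⟨h2, h1⟩⟩
  push Not at h0 h1
  exact .inr (Fin.forall_fin_two.2 ⟨isNilpotent_of_forall_hasEigenvalue h0,
    isNilpotent_of_forall_hasEigenvalue h1⟩)

end Commuting

section Kleinian

variable {Γ : Subgroup (Matrix.SpecialLinearGroup (Fin 2) ℂ)} {I K : Type} [Fintype I]
  [Fintype K] {S : SimpleReps Γ I} {D : Decomposition S K} {φ : CGDatum S}

/-! ### The preprojective relation of a regular datum -/

variable (Q : KleinianQuiver S D) (φ)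

/-- The polarization of the preprojective relation of `R(φ, x)`. -/
def polarRelation (v : I) : (Fin 2 → ℂ) →ₗ[ℂ] (Fin 2 → ℂ) →ₗ[ℂ] (S.U v →ₗ[ℂ] S.U v) :=
  ∑ j : I, ∑ b : Arrow S D v j, Q.sign b •
    ((LinearMap.llcomp ℂ (S.U v) (S.U j) (S.U v)).flip.compl₁₂
      (LinearMap.proj b ∘ₗ LinearMap.proj j ∘ₗ LinearMap.proj v ∘ₗ comparisonBilin S D φ)
      (LinearMap.proj (Q.star b) ∘ₗ LinearMap.proj v ∘ₗ LinearMap.proj j ∘ₗ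
        comparisonBilin S D φ))

theorem polarRelation_apply (v : I) (x y : Fin 2 → ℂ) (u : S.U v) :
    polarRelation φ Q v x y u = ∑ j : I, ∑ b : Arrow S D v j, Q.sign b •
      comparison S D (φ, y) j v (Q.star b) (comparison S D (φ, x) v j b u) := by
  simp [polarRelation, LinearMap.sum_apply, comparisonBilin_apply]

variable {φ}

theorem sum_polarRelation (hφ : IsRegular S φ) (v : I) (y : Fin 2 → ℂ) (w : Fin 2 → S.U v) :
    ∑ n, polarRelation φ Q v (Pi.single n 1) y (w n) = ∑ j : I, ∑ b : Arrow S D v j, Q.sign b •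
      comparison S D (φ, y) j v (Q.star b) (outEquiv hφ v w j b) := by
  simp only [polarRelation_apply]
  rw [Finset.sum_comm]
  refine Finset.sum_congr rfl fun j _ => ?_
  rw [Finset.sum_comm]
  refine Finset.sum_congr rfl fun b _ => ?_
  rw [outEquiv_apply, map_sum, Finset.smul_sum]

variable {Q}

/-- The relations at `R(φ, x)` say that the polarization is alternating. On a plane it is then a
multiple of the determinant. -/
theorem polarRelation_eq (hQ : ∀ x, comparison S D (φ, x) ∈ preprojectiveRep S D Q) (v : I)
    (x y : Fin 2 → ℂ) : polarRelation φ Q v x y =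
      (x 0 * y 1 - x 1 * y 0) • polarRelation φ Q v (Pi.single 0 1) (Pi.single 1 1) := by
  have halt : (polarRelation φ Q v).IsAlt := fun x => by
    refine LinearMap.ext fun u => ?_
    have := (mem_preprojectiveRep_iff Q).1 (hQ x) v
    rw [polarRelation_apply, ← relation_apply, this]
  have hx : ∀ x : Fin 2 → ℂ, x = x 0 • Pi.single 0 1 + x 1 • Pi.single 1 1 := fun x => by
    ext n; fin_cases n <;> simp
  conv_lhs => rw [hx x, hx y]
  simp only [map_add, map_smul, LinearMap.add_apply, LinearMap.smul_apply, halt.self_eq_zero,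
    ← halt.neg (Pi.single 0 1) (Pi.single 1 1)]
  module

/-- Equivariance of `φ` moves `g` onto both vector arguments, where it acts through its determinant,
which is `1`. -/
theorem polarRelation_equivariant (hφ : IsRegular S φ)
    (hQ : ∀ x, comparison S D (φ, x) ∈ preprojectiveRep S D Q) (v : I) (g : Γ) (u : S.U v) :
    polarRelation φ Q v (Pi.single 0 1) (Pi.single 1 1) (S.rep v g u) =
      S.rep v g (polarRelation φ Q v (Pi.single 0 1) (Pi.single 1 1) u) := by
  have h1 : polarRelation φ Q v (g.1.1.mulVec (Pi.single 0 1)) (g.1.1.mulVec (Pi.single 1 1)) =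
      polarRelation φ Q v (Pi.single 0 1) (Pi.single 1 1) := by
    rw [polarRelation_eq hQ]
    have hdet := g.1.2
    rw [Matrix.det_fin_two] at hdet
    have : (g.1.1.mulVec (Pi.single 0 1) 0 * g.1.1.mulVec (Pi.single 1 1) 1 -
        g.1.1.mulVec (Pi.single 0 1) 1 * g.1.1.mulVec (Pi.single 1 1) 0 : ℂ) = 1 := by
      simp only [Matrix.mulVec_single_one, Matrix.col_apply]
      linear_combination hdet
    rw [this, one_smul]
  conv_lhs => rw [← h1]
  simp only [polarRelation_apply, comparison_equivariant hφ, map_sum, map_smul]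

/-- By Schur it is enough that the map is nonzero. If it were zero, the whole polarization would
vanish. Since `outEquiv` makes the vectors at the heads of the arrows out of `v` arbitrary, some
arrow `b*` would then act by zero in every `R(φ, y)`. This is absurd, because the images of the `b*`
span `U v`. -/
theorem polarRelation_injective (hφ : IsRegular S φ)
    (hQ : ∀ x, comparison S D (φ, x) ∈ preprojectiveRep S D Q) (v : I) :
    Function.Injective (polarRelation φ Q v (Pi.single 0 1) (Pi.single 1 1)) := by
  classical
  refine S.injective_of_ne_zero _ (polarRelation_equivariant hφ hQ v) fun h0 => ?_
  have hzero : ∀ x y, polarRelation φ Q v x y = 0 := fun x y => by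
    rw [polarRelation_eq hQ, h0, smul_zero]
  obtain ⟨j, ⟨b⟩⟩ : ∃ j, Nonempty (Arrow S D v j) := by
    by_contra! h
    obtain ⟨u, hu⟩ := exists_ne (0 : S.U v)
    have : (fun _ : Fin 2 => u) = 0 := (outEquiv (D := D) hφ v).injective (by
      funext j a
      exact (h j).elim a)
    exact hu (congrFun this 0)
  -- Tested on the tensor whose only nonzero component is `z` at the arrow `b`.
  have hb : ∀ (y : Fin 2 → ℂ) (z : S.U j), comparison S D (φ, y) j v (Q.star b) z = 0 := by
    intro y z
    have := sum_polarRelation Q hφ v y ((outEquiv hφ v).symm (Pi.single j (Pi.single b z)))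
    rw [LinearEquiv.apply_symm_apply, Finset.sum_eq_single_of_mem j (Finset.mem_univ _),
      Finset.sum_eq_single_of_mem b (Finset.mem_univ _)] at this
    · simpa [hzero, Q.sign_ne_zero] using this.symm
    · intro b' _ hb'
      simp [hb']
    · intro j' _ hj'
      simp [hj']
  obtain ⟨u, hu⟩ := exists_ne (0 : S.U v)
  have := outEquiv_symm_spec (D := D) hφ (fun i _ => if h : v = i then h ▸ u else 0) (Q.star b)
  simp only [hb, Finset.sum_const_zero, dite_true] at this
  exact hu this.symm

/-! ### The operators attached to a representation of the double quiver -/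

/-- The space on which a representation of the double quiver gives two operators. -/
abbrev HomSpace (S : SimpleReps Γ I) : Type := ∀ i : I, S.U i →ₗ[ℂ] S.U i

/-- The operators on `⊕ Hom (U i, U i)` attached to a representation of the double quiver. -/
def shiftOp (hφ : IsRegular S φ) (ρ : DoubleRep S D) (n : Fin 2) :
    Module.End ℂ (HomSpace S) where
  toFun h i := LinearMap.proj n ∘ₗ (outEquiv hφ i).symm.toLinearMap ∘ₗ
    LinearMap.pi fun j => LinearMap.pi fun a => h j ∘ₗ ρ i j a
  map_add' h h' := by
    funext i
    refine LinearMap.ext fun u => ?_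
    exact congrFun ((outEquiv hφ i).symm.map_add (fun j a => h j (ρ i j a u))
      (fun j a => h' j (ρ i j a u))) n
  map_smul' c h := by
    funext i
    refine LinearMap.ext fun u => ?_
    exact congrFun ((outEquiv hφ i).symm.map_smul c (fun j a => h j (ρ i j a u))) n

omit [Fintype I] in
theorem shiftOp_apply (hφ : IsRegular S φ) (ρ : DoubleRep S D) (n : Fin 2) (h : HomSpace S)
    (i : I) (u : S.U i) :
    shiftOp hφ ρ n h i u = (outEquiv hφ i).symm (fun j a => h j (ρ i j a u)) n := rfl

omit [Fintype I] in
-- This identity characterizes the operators. It shows that a joint eigenvector with eigenvalue `x`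
-- is the same as a morphism from `ρ` to `R(φ, x)`.
theorem outEquiv_shiftOp (hφ : IsRegular S φ) (ρ : DoubleRep S D) (h : HomSpace S) {i j : I}
    (a : Arrow S D i j) (u : S.U i) :
    outEquiv hφ i (fun n => shiftOp hφ ρ n h i u) j a = h j (ρ i j a u) := by
  simp only [shiftOp_apply]
  rw [LinearEquiv.apply_symm_apply]

/-- The polarized relation of `φ`, applied to the products of two operators, collapses to `h`
composed with the relation of `ρ`, which is zero. As the polarization is the determinant times an
injective map, what remains is that the commutator vanishes. -/
theorem shiftOp_commute (hφ : IsRegular S φ)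
    (hQ : ∀ x, comparison S D (φ, x) ∈ preprojectiveRep S D Q) {ρ : DoubleRep S D}
    (hρ : ρ ∈ preprojectiveRep S D Q) : Commute (shiftOp hφ ρ 0) (shiftOp hφ ρ 1) := by
  refine LinearMap.ext fun h => funext fun v => LinearMap.ext fun u => ?_
  rw [← sub_eq_zero]
  apply polarRelation_injective hφ hQ v
  rw [map_zero]
  have key : ∑ m, ∑ n, polarRelation φ Q v (Pi.single n 1) (Pi.single m 1)
      (shiftOp hφ ρ n (shiftOp hφ ρ m h) v u) = h v (relation Q ρ v u) := by
    simp only [sum_polarRelation Q hφ, outEquiv_shiftOp]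
    rw [Finset.sum_comm, relation_apply, map_sum]
    refine Finset.sum_congr rfl fun j _ => ?_
    rw [Finset.sum_comm, map_sum]
    refine Finset.sum_congr rfl fun b _ => ?_
    rw [← Finset.smul_sum, map_smul, ← outEquiv_apply hφ, outEquiv_shiftOp]
  rw [(mem_preprojectiveRep_iff Q).1 hρ v, LinearMap.zero_apply, map_zero] at key
  simp only [Fin.sum_univ_two] at key
  rw [polarRelation_eq hQ v (Pi.single 0 1) (Pi.single 0 1),
    polarRelation_eq hQ v (Pi.single 1 1) (Pi.single 1 1),
    polarRelation_eq hQ v (Pi.single 1 1) (Pi.single 0 1)] at key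
  simp only [Pi.single_eq_same, Fin.isValue, ne_eq, one_ne_zero, not_false_eq_true, zero_ne_one,
    Pi.single_eq_of_ne, mul_zero, mul_one, sub_self, zero_smul, LinearMap.zero_apply, zero_add,
    add_zero, zero_sub, LinearMap.smul_apply, neg_smul, one_smul] at key
  rw [Module.End.mul_apply, Module.End.mul_apply, map_sub]
  rw [← key]
  abel

end Kleinian

end ClebschGordan

namespace ClebschGordan

/-! ### Gradings adapted to a filtration -/

section Grading

variable {V : Type*} [AddCommGroup V] [Module ℂ V]

/-- Independent projections onto the steps need not be compatible. Composing each one with all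
earlier ones makes their kernels increase. -/
theorem exists_adapted_projections (F : ℕ → Submodule ℂ V) (h0 : F 0 = ⊤) (hF : Antitone F) :
    ∃ e : ℕ → Module.End ℂ V, e 0 = 1 ∧ (∀ m v, e m v ∈ F m) ∧ (∀ m, ∀ v ∈ F m, e m v = v) ∧
      ∀ m n, n ≤ m → e m * e n = e m := by
  have hq : ∀ m, ∃ q : Module.End ℂ V, (∀ v, q v ∈ F m) ∧ ∀ v ∈ F m, q v = v := fun m => by
    obtain ⟨q, hq⟩ := (F m).subtype.exists_leftInverse_of_injective (F m).ker_subtype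
    exact ⟨(F m).subtype ∘ₗ q, fun v => (q v).2, fun v hv =>
      congrArg Subtype.val (LinearMap.congr_fun hq ⟨v, hv⟩)⟩
  choose q hq1 hq2 using hq
  let e : ℕ → Module.End ℂ V := fun m => Nat.rec 1 (fun m e => q (m + 1) * e) m
  have he : ∀ m, e (m + 1) = q (m + 1) * e m := fun _ => rfl
  have hfix : ∀ m, ∀ v ∈ F m, e m v = v := by
    intro m
    induction m with
    | zero => intro v _; rfl
    | succ m ih =>
      intro v hv
      rw [he, Module.End.mul_apply, ih v (hF m.le_succ hv), hq2 _ v hv]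
  have hmem : ∀ m v, e m v ∈ F m := by
    intro m v
    cases m with
    | zero => rw [h0]; trivial
    | succ m => exact hq1 _ _
  refine ⟨e, rfl, hmem, hfix, fun m n hnm => ?_⟩
  induction m, hnm using Nat.le_induction with
  | base => exact LinearMap.ext fun v => hfix n _ (hmem n v)
  | succ m _ ih => rw [he, mul_assoc, ih]

/-- The differences `e m - e (m + 1)` of compatible projections are orthogonal idempotents, and
their sum telescopes. -/
theorem exists_adapted_grading (F : ℕ → Submodule ℂ V) (h0 : F 0 = ⊤) (hF : Antitone F) {M : ℕ}
    (hM : F M = ⊥) : ∃ π : ℕ → Module.End ℂ V, (∀ m n, π m * π n = if m = n then π m else 0) ∧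
      ∑ m ∈ Finset.range M, π m = 1 ∧ (∀ m v, π m v ∈ F m) ∧ ∀ m, ∀ v ∈ F (m + 1), π m v = 0 := by
  obtain ⟨e, he0, he1, he2, he3⟩ := exists_adapted_projections F h0 hF
  have he4 : ∀ m n, m ≤ n → e m * e n = e n := fun m n hmn =>
    LinearMap.ext fun v => he2 m _ (hF hmn (he1 n v))
  refine ⟨fun m => e m - e (m + 1), fun m n => ?_, ?_, fun m v => ?_, fun m v hv => ?_⟩
  · rw [sub_mul, mul_sub, mul_sub]
    rcases lt_trichotomy m n with h | rfl | h
    · rw [he4 m n h.le, he4 m _ (by lia), he4 _ n h, he4 _ (n + 1) (by lia), if_neg h.ne]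
      simp
    · rw [he3 m m le_rfl, he4 m (m + 1) (by lia), he3 (m + 1) m (by lia), he3 _ _ le_rfl]
      simp
    · rw [he3 m n h.le, he3 m _ h, he3 _ n (by lia), he3 _ (n + 1) (by lia), if_neg h.ne']
      simp
  · rw [Finset.sum_range_sub', he0, sub_eq_self]
    refine LinearMap.ext fun v => ?_
    simpa [hM] using he1 M v
  · exact sub_mem (he1 m v) (hF m.le_succ (he1 _ v))
  · rw [LinearMap.sub_apply, he2 m v (hF m.le_succ hv), he2 _ v hv, sub_self]

/-- The one-parameter group that acts on the `m`-th graded piece by `t ^ m`. -/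
def gradingEquiv {M : ℕ} {π : ℕ → Module.End ℂ V}
    (h1 : ∀ m n, π m * π n = if m = n then π m else 0) (h2 : ∑ m ∈ Finset.range M, π m = 1)
    {t : ℂ} (ht : t ≠ 0) : V ≃ₗ[ℂ] V :=
  have key : ∀ s t : ℂ, s * t = 1 → (∑ m ∈ Finset.range M, s ^ m • π m) *
      ∑ m ∈ Finset.range M, t ^ m • π m = 1 := fun s t hst => by
    rw [← h2, Finset.sum_mul_sum]
    refine Finset.sum_congr rfl fun m hm => ?_
    rw [Finset.sum_eq_single_of_mem m hm fun n _ hn => by simp [h1, hn.symm]]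
    simp [h1, smul_smul, ← mul_pow, mul_comm t s, hst]
  LinearEquiv.ofLinearMap (∑ m ∈ Finset.range M, t ^ m • π m)
    (∑ m ∈ Finset.range M, t⁻¹ ^ m • π m) (key _ _ (mul_inv_cancel₀ ht))
    (key _ _ (inv_mul_cancel₀ ht))

end Grading

section Kleinian

variable {Γ : Subgroup (Matrix.SpecialLinearGroup (Fin 2) ℂ)} {I K : Type}
  {S : SimpleReps Γ I} {D : Decomposition S K} {φ : CGDatum S}

/-! ### Change of basis without normalization at the trivial representation -/

/-- A common scalar at all vertices acts trivially on representations of the quiver, so the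
component at the trivial vertex can be scaled to `1`. -/
theorem exists_gaugeRep_eq_conjRep (g : ∀ i, S.U i ≃ₗ[ℂ] S.U i) :
    ∃ g' : gaugeGroup S, ∀ ρ : DoubleRep S D, gaugeRep S D g' ρ = conjRep S D g ρ := by
  obtain ⟨c, hc⟩ := S.eq_smul_id S.zero (g S.zero).toLinearMap (by simp [S.rep_zero])
  have hc' : ∀ u, g S.zero u = c • u := fun u => LinearMap.congr_fun hc u
  have hc0 : c ≠ 0 := by
    rintro rfl
    obtain ⟨u, hu⟩ := exists_ne (0 : S.U S.zero)
    exact hu ((g S.zero).injective (by rw [hc', zero_smul, map_zero]))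
  refine ⟨⟨fun i => g i ≪≫ₗ LinearEquiv.smulOfNeZero ℂ (S.U i) c⁻¹ (inv_ne_zero hc0), ?_⟩,
    fun ρ => ?_⟩
  · refine LinearEquiv.ext fun u => ?_
    simp [hc', hc0]
  · funext i j a
    refine LinearMap.ext fun u => ?_
    have h1 : (g i ≪≫ₗ LinearEquiv.smulOfNeZero ℂ (S.U i) c⁻¹ (inv_ne_zero hc0)).symm u =
        c • (g i).symm u := by
      rw [LinearEquiv.symm_apply_eq]
      simp [hc0]
    change c⁻¹ • g j (ρ i j a ((g i ≪≫ₗ LinearEquiv.smulOfNeZero ℂ (S.U i) c⁻¹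
      (inv_ne_zero hc0)).symm u)) = g j (ρ i j a ((g i).symm u))
    rw [h1]
    simp [hc0]

theorem invariantRing_conjRep {X : Set (DoubleRep S D)} {f : X → ℂ}
    (hf : f ∈ invariantRing (gaugeRep S D) X) (g : ∀ i, S.U i ≃ₗ[ℂ] S.U i) (ρ ρ' : X)
    (h : conjRep S D g ρ = ρ') : f ρ' = f ρ := by
  obtain ⟨g', hg'⟩ := exists_gaugeRep_eq_conjRep (D := D) g
  exact hf.2 g' ρ ρ' (by rw [hg', h])

/-! ### Degeneration of nilpotent representations -/

/-- In gradings adapted to `F` every arrow raises the degree. Conjugation by `t ^ degree` multiplies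
the part of degree `k` by `t ^ k`, so only positive powers of `t` occur and the curve tends to `0`.
-/
theorem exists_degeneration (ρ : DoubleRep S D) (F : ℕ → ∀ i, Submodule ℂ (S.U i))
    (h0 : ∀ i, F 0 i = ⊤) (hF : ∀ i m, F (m + 1) i ≤ F m i) {M : ℕ} (hM : ∀ i, F M i = ⊥)
    (hρ : ∀ m i j (a : Arrow S D i j), ∀ u ∈ F m i, ρ i j a u ∈ F (m + 1) j) :
    ∃ w : ℕ → DoubleRep S D, w 0 = 0 ∧ ∀ t : ℂ, t ≠ 0 → ∃ g : ∀ i, S.U i ≃ₗ[ℂ] S.U i,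
      conjRep S D g ρ = ∑ k ∈ Finset.range M, t ^ k • w k := by
  choose π h1 h2 h3 h4 using fun i => exists_adapted_grading (fun m => F m i) (h0 i)
    (antitone_nat_of_succ_le (hF i)) (hM i)
  -- The condition `k ≠ 0` makes `w 0 = 0` immediate. It loses nothing, because by `hzero` the parts
  -- of degree at most `0` vanish.
  refine ⟨fun k i j a => ∑ m ∈ Finset.range M, ∑ n ∈ Finset.range M,
    if m = n + k ∧ k ≠ 0 then π j m ∘ₗ ρ i j a ∘ₗ π i n else 0, ?_, fun t ht =>
      ⟨fun i => gradingEquiv (h1 i) (h2 i) ht, ?_⟩⟩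
  · funext i j a
    simp
  · funext i j a
    have hzero : ∀ m n, m ≤ n → π j m ∘ₗ ρ i j a ∘ₗ π i n = 0 := fun m n hmn =>
      LinearMap.ext fun u => h4 j m _ (antitone_nat_of_succ_le (f := fun m => F m j) (hF j)
        (Nat.succ_le_succ hmn) (hρ n i j a _ (h3 i n u)))
    have hl : conjRep S D (fun i => gradingEquiv (h1 i) (h2 i) ht) ρ i j a =
        ∑ m ∈ Finset.range M, ∑ n ∈ Finset.range M,
          (t ^ m * t⁻¹ ^ n) • (π j m ∘ₗ ρ i j a ∘ₗ π i n) := by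
      refine LinearMap.ext fun u => ?_
      change (∑ m ∈ Finset.range M, t ^ m • π j m)
        (ρ i j a ((∑ n ∈ Finset.range M, t⁻¹ ^ n • π i n) u)) = _
      simp only [LinearMap.sum_apply, LinearMap.smul_apply, map_sum, map_smul,
        LinearMap.comp_apply, Finset.smul_sum, smul_smul]
      rw [Finset.sum_comm]
      simp only [mul_comm]
    rw [hl]
    simp only [Finset.sum_apply, Pi.smul_apply, Finset.smul_sum]
    symm
    rw [Finset.sum_comm]
    refine Finset.sum_congr rfl fun m hm => ?_
    rw [Finset.sum_comm]
    refine Finset.sum_congr rfl fun n _ => ?_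
    rcases le_or_gt m n with hmn | hmn
    · rw [hzero m n hmn]
      simp
    · rw [Finset.sum_eq_single_of_mem (m - n)
        (Finset.mem_range.2 ((Nat.sub_le _ _).trans_lt (Finset.mem_range.1 hm)))]
      · rw [if_pos ⟨by lia, by lia⟩]
        congr 1
        rw [inv_pow, ← div_eq_mul_inv, pow_sub₀ _ ht hmn.le, div_eq_mul_inv]
      · intro k _ hk
        rw [if_neg (by lia), smul_zero]

variable [Fintype I] [Fintype K]

/-- The image of all paths of length `m`. -/
def pathFiltration (ρ : DoubleRep S D) : ℕ → ∀ i, Submodule ℂ (S.U i)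
  | 0, _ => ⊤
  | m + 1, j => ⨆ i, ⨆ a : Arrow S D i j, (pathFiltration ρ m i).map (ρ i j a)

omit [Fintype I] [Fintype K] in
theorem apply_mem_pathFiltration (ρ : DoubleRep S D) (m : ℕ) (i j : I) (a : Arrow S D i j)
    (u : S.U i) (hu : u ∈ pathFiltration ρ m i) : ρ i j a u ∈ pathFiltration ρ (m + 1) j :=
  Submodule.mem_iSup_of_mem i (Submodule.mem_iSup_of_mem a (Submodule.mem_map_of_mem hu))

omit [Fintype I] [Fintype K] in
theorem pathFiltration_succ_le (ρ : DoubleRep S D) (i : I) (m : ℕ) :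
    pathFiltration ρ (m + 1) i ≤ pathFiltration ρ m i := by
  induction m generalizing i with
  | zero => exact le_top
  | succ m ih => exact iSup_mono fun j => iSup_mono fun a => Submodule.map_mono (ih j)

omit [Fintype I] in
-- By `outEquiv_shiftOp`, the composite of `h` with an arrow is determined by the values of the two
-- operators at `h`. So `h` on the image of paths of length `m` is governed by the monomials of
-- degree `m` in the operators.
theorem pathFiltration_le_ker (hφ : IsRegular S φ) {ρ : DoubleRep S D}
    (hcomm : Commute (shiftOp hφ ρ 0) (shiftOp hφ ρ 1)) (m : ℕ) (h : HomSpace S)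
    (hh : ∀ a b, a + b = m → (shiftOp hφ ρ 0 ^ a * shiftOp hφ ρ 1 ^ b) h = 0) (j : I) :
    pathFiltration ρ m j ≤ LinearMap.ker (h j) := by
  induction m generalizing h j with
  | zero =>
    have : h = 0 := by simpa using hh 0 0 rfl
    simp [this]
  | succ m ih =>
    refine iSup_le fun i => iSup_le fun a => Submodule.map_le_iff_le_comap.2 fun u hu => ?_
    have hn : ∀ n, shiftOp hφ ρ n h i u = 0 := by
      intro n
      refine LinearMap.mem_ker.1 (ih (shiftOp hφ ρ n h) (fun a b hab => ?_) i hu)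
      rw [← Module.End.mul_apply]
      fin_cases n
      · have := hh (a + 1) b (by lia)
        rwa [pow_succ, mul_assoc, (hcomm.pow_right b).eq, ← mul_assoc] at this
      · have := hh a (b + 1) (by lia)
        rwa [pow_succ, ← mul_assoc] at this
    rw [Submodule.mem_comap, LinearMap.mem_ker, ← outEquiv_shiftOp hφ]
    simp only [hn]
    exact congrFun (congrFun ((outEquiv (D := D) hφ i).map_zero) j) a

omit [Fintype I] in
-- A monomial of degree `N0 + N1` contains a vanishing power of one of the two operators. With `h`
-- the identity, the kernels in `pathFiltration_le_ker` are zero.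
theorem exists_pathFiltration_eq_bot (hφ : IsRegular S φ) {ρ : DoubleRep S D}
    (hcomm : Commute (shiftOp hφ ρ 0) (shiftOp hφ ρ 1))
    (hnil : ∀ n, IsNilpotent (shiftOp hφ ρ n)) : ∃ M, ∀ j, pathFiltration ρ M j = ⊥ := by
  obtain ⟨N0, h0⟩ := hnil 0
  obtain ⟨N1, h1⟩ := hnil 1
  refine ⟨N0 + N1, fun j => ?_⟩
  have := pathFiltration_le_ker hφ hcomm (N0 + N1) (fun _ => LinearMap.id) (fun a b hab => ?_) j
  · simpa using this
  · rcases le_or_gt N0 a with h | h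
    · rw [pow_eq_zero_of_le h h0, zero_mul, LinearMap.zero_apply]
    · rw [pow_eq_zero_of_le (by lia : N1 ≤ b) h1, mul_zero, LinearMap.zero_apply]

/-! ### Invariants are determined by their values on the representations `R(φ, x)` -/

/-- The eigenvector `h` is a nonzero morphism into a simple representation, hence surjective at
every vertex, and bijective since the dimension vectors agree. -/
theorem exists_conjRep_eq_comparison [Finite Γ] (hφ : IsRegular S φ) {ρ : DoubleRep S D}
    {x : Fin 2 → ℂ} (hx : x ≠ 0) {h : HomSpace S} (hh : h ≠ 0)
    (heig : ∀ n, shiftOp hφ ρ n h = x n • h) :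
    ∃ g : ∀ i, S.U i ≃ₗ[ℂ] S.U i, conjRep S D g ρ = comparison S D (φ, x) := by
  have hmor : ∀ i j (a : Arrow S D i j) u,
      comparison S D (φ, x) i j a (h i u) = h j (ρ i j a u) := fun i j a u => by
    rw [← outEquiv_shiftOp hφ, ← outEquiv_tmul hφ]
    simp only [heig, Pi.smul_apply, LinearMap.smul_apply]
  obtain ⟨i, hi⟩ := Function.ne_iff.1 hh
  have hsurj : ∀ j, Function.Surjective (h j) := fun j => LinearMap.range_eq_top.1 <|
    eq_top_of_stable hφ hx (fun i => LinearMap.range (h i))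
      (by
        rintro i j a _ ⟨u, rfl⟩
        exact ⟨_, (hmor i j a u).symm⟩)
      (i := i) (fun h => hi (LinearMap.range_eq_bot.1 h)) j
  have hbij : ∀ j, Function.Bijective (h j) := fun j =>
    ⟨LinearMap.injective_iff_surjective.2 (hsurj j), hsurj j⟩
  refine ⟨fun i => LinearEquiv.ofBijective (h i) (hbij i), ?_⟩
  funext i j a
  refine LinearMap.ext fun u => ?_
  obtain ⟨u, rfl⟩ := hsurj i u
  rw [hmor]
  have hsymm : (LinearEquiv.ofBijective (h i) (hbij i)).symm (h i u) = u := by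
    rw [LinearEquiv.symm_apply_eq, LinearEquiv.ofBijective_apply]
  change h j (ρ i j a ((LinearEquiv.ofBijective (h i) (hbij i)).symm (h i u))) = _
  rw [hsymm]

/-- The values of the invariant functions at a representation of the preprojective algebra are
their values at some `R(φ, x)`. -/
theorem exists_forall_invariant_eq [Finite Γ] (hφ : IsRegular S φ) {Q : KleinianQuiver S D}
    (hQ : ∀ x, comparison S D (φ, x) ∈ preprojectiveRep S D Q)
    (ρ : preprojectiveRep S D Q) : ∃ x, ∀ f ∈ invariantRing (gaugeRep S D)
      (preprojectiveRep S D Q), f ρ = f ⟨_, hQ x⟩ := by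
  have hcomm := shiftOp_commute hφ hQ ρ.2
  rcases joint_eigenvector_or_isNilpotent hcomm with ⟨x, h, hx, hh, heig⟩ | hnil
  · obtain ⟨g, hg⟩ := exists_conjRep_eq_comparison hφ hx hh heig
    exact ⟨x, fun f hf => (invariantRing_conjRep hf g ρ ⟨_, hQ x⟩ hg).symm⟩
  -- In the nilpotent case a curve in the orbit of `ρ` tends to `0 = R(φ, 0)`. An invariant function
  -- is constant along it, also in the limit.
  · refine ⟨0, fun f hf => ?_⟩
    obtain ⟨M, hM⟩ := exists_pathFiltration_eq_bot hφ hcomm hnil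
    obtain ⟨w, hw0, hw⟩ := exists_degeneration ρ.1 (pathFiltration ρ.1) (fun _ => rfl)
      (pathFiltration_succ_le ρ.1) hM (apply_mem_pathFiltration ρ.1)
    obtain ⟨F, hF, hFf⟩ := exists_extension hf.1
    have hlim : F ⟨∑ n ∈ Finset.range M, (0 : ℂ) ^ n • w n, trivial⟩ = f ρ := by
      refine eq_of_const_along_curve hF M w (f ρ) fun t ht => ?_
      obtain ⟨g, hg⟩ := hw t ht
      have hmem := conjRep_mem_preprojectiveRep Q g ρ.2
      rw [← invariantRing_conjRep hf g ρ ⟨_, hmem⟩ rfl, ← hFf]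
      congr 2
      exact hg.symm
    rw [← hlim, ← hFf]
    congr 2
    change _ = comparisonBilin S D φ 0
    rw [map_zero]
    refine Finset.sum_eq_zero fun n _ => ?_
    rcases eq_or_ne n 0 with rfl | hn
    · rw [hw0, smul_zero]
    · rw [zero_pow hn, zero_smul]

end Kleinian

end ClebschGordan

namespace ClebschGordan

/-! ### Averaging -/

section Average

variable {G : Type} [Group G] [Fintype G] {V W : Type*} [AddCommGroup V] [Module ℂ V]
  [AddCommGroup W] [Module ℂ W] (ρ : Representation ℂ G V) (σ : Representation ℂ G W)

/-- The sum of the conjugates of a linear map under a finite group. -/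
def sumConj (T : V →ₗ[ℂ] W) : V →ₗ[ℂ] W := ∑ g : G, σ g ∘ₗ T ∘ₗ ρ g⁻¹

theorem sumConj_apply (T : V →ₗ[ℂ] W) (v : V) :
    sumConj ρ σ T v = ∑ g : G, σ g (T (ρ g⁻¹ v)) := by
  simp [sumConj, LinearMap.sum_apply]

theorem sumConj_equivariant (T : V →ₗ[ℂ] W) (g : G) (v : V) :
    sumConj ρ σ T (ρ g v) = σ g (sumConj ρ σ T v) := by
  simp only [sumConj_apply, map_sum]
  refine Fintype.sum_equiv (Equiv.mulLeft g⁻¹) _ _ fun h => ?_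
  rw [← Module.End.mul_apply (ρ h⁻¹), ← Module.End.mul_apply (σ g), ← map_mul, ← map_mul]
  simp

/-- An equivariant linear map on a stable subspace extends to the whole representation. -/
theorem exists_equivariant_extension (A : Submodule ℂ V) (hA : ∀ g, ∀ v ∈ A, ρ g v ∈ A)
    (T : A →ₗ[ℂ] W) (hT : ∀ g (v : A), T ⟨ρ g v, hA g v v.2⟩ = σ g (T v)) :
    ∃ T' : V →ₗ[ℂ] W, (∀ g v, T' (ρ g v) = σ g (T' v)) ∧ ∀ v : A, T' v = T v := by
  obtain ⟨T₀, hT₀⟩ := T.exists_extend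
  have hT₀' : ∀ v : A, T₀ v = T v := fun v => LinearMap.congr_fun hT₀ v
  refine ⟨(Fintype.card G : ℂ)⁻¹ • sumConj ρ σ T₀, fun g v => ?_, fun v => ?_⟩
  · simp [sumConj_equivariant]
  · have h : ∀ g : G, σ g (T₀ (ρ g⁻¹ v)) = T v := fun g => by
      have := hT₀' ⟨ρ g⁻¹ v, hA g⁻¹ v v.2⟩
      simp only at this
      rw [this, hT, ← Module.End.mul_apply, ← map_mul]
      simp
    have hc : (Fintype.card G : ℂ) ≠ 0 := Nat.cast_ne_zero.2 Fintype.card_ne_zero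
    rw [LinearMap.smul_apply, sumConj_apply]
    simp only [h, Finset.sum_const, Finset.card_univ]
    rw [← Nat.cast_smul_eq_nsmul ℂ, smul_smul, inv_mul_cancel₀ hc, one_smul]

end Average

/-! ### Complete reducibility -/

section Regular

variable {G : Type} [Group G] [Finite G] {I : Type} (S : SimpleReps G I)

/-- Induction on the dimension: a reducible `σ` has a smaller nonzero subrepresentation, and an
equivariant map from that extends by averaging. Coordinates are carried along because the list of
simple representations is written on columns. -/
theorem SimpleReps.exists_ne_zero_to_simple (d : ℕ) (σ : Representation ℂ G (Fin d → ℂ))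
    (hd : d ≠ 0) : ∃ (k : I) (T : (Fin d → ℂ) →ₗ[ℂ] S.U k), T ≠ 0 ∧
      ∀ g v, T (σ g v) = S.rep k g (T v) := by
  have := Fintype.ofFinite G
  induction d using Nat.strong_induction_on with
  | _ d ih =>
  have : NeZero d := ⟨hd⟩
  by_cases hσ : σ.IsIrreducible
  · obtain ⟨k, ⟨e⟩⟩ := S.exists_equiv d σ hσ
    refine ⟨k, e.toLinearMap, fun h => ?_, fun g v =>
      Representation.IntertwiningMap.isIntertwining _ _ e.toIntertwiningMap g v⟩
    obtain ⟨v, hv⟩ := exists_ne (0 : Fin d → ℂ)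
    exact hv (e.toLinearEquiv.injective ((LinearMap.congr_fun h v).trans (map_zero _).symm))
  · have hnt : Nontrivial (Subrepresentation σ) := by
      refine ⟨⊥, ⊤, fun h => ?_⟩
      have := congrArg Subrepresentation.toSubmodule h
      exact bot_ne_top (α := Submodule ℂ (Fin d → ℂ)) this
    obtain ⟨A, hA⟩ : ∃ A : Subrepresentation σ, ¬(A = ⊥ ∨ A = ⊤) := by
      by_contra! h
      exact hσ { eq_bot_or_eq_top := h }
    push Not at hA
    have hA0 : A.toSubmodule ≠ ⊥ := fun h => hA.1 (Subrepresentation.toSubmodule_injective h)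
    have hA1 : A.toSubmodule ≠ ⊤ := fun h => hA.2 (Subrepresentation.toSubmodule_injective h)
    have hlt : Module.finrank ℂ A.toSubmodule < d := by
      simpa using Submodule.finrank_lt hA1
    have hne : Module.finrank ℂ A.toSubmodule ≠ 0 := fun h =>
      hA0 (Submodule.finrank_eq_zero.1 h)
    let e := (Module.finBasis ℂ A.toSubmodule).equivFun
    obtain ⟨k, T, hT0, hT⟩ := ih _ hlt
      (e.conjAlgEquiv ℂ |>.toAlgHom.toMonoidHom.comp A.toRepresentation) hne
    obtain ⟨T', hT', hext⟩ := exists_equivariant_extension σ (S.rep k) A.toSubmodule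
      (fun g v hv => A.apply_mem_toSubmodule g hv) (T ∘ₗ e.toLinearMap) fun g v => by
        have := hT g (e v)
        rw [LinearMap.comp_apply, LinearMap.comp_apply]
        refine Eq.trans ?_ this
        congr 1
        change e _ = e (A.toRepresentation g (e.symm (e v)))
        rw [e.symm_apply_apply]
        rfl
    refine ⟨k, T', fun h => hT0 (LinearMap.ext fun y => ?_), hT'⟩
    have := hext (e.symm y)
    rw [h] at this
    simpa using this.symm

theorem SimpleReps.exists_equivariant_ne_zero {V : Type} [AddCommGroup V] [Module ℂ V]
    [FiniteDimensional ℂ V] (ρ : Representation ℂ G V) (A : Submodule ℂ V)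
    (hA : ∀ g, ∀ v ∈ A, ρ g v ∈ A) (hA0 : A ≠ ⊥) :
    ∃ (k : I) (T : ρ.IntertwiningMap (S.rep k)), ∃ v ∈ A, T v ≠ 0 := by
  have := Fintype.ofFinite G
  let A' : Subrepresentation ρ := ⟨A, hA⟩
  let e := (Module.finBasis ℂ A).equivFun
  obtain ⟨k, T, hT0, hT⟩ := S.exists_ne_zero_to_simple _
    (e.conjAlgEquiv ℂ |>.toAlgHom.toMonoidHom.comp A'.toRepresentation)
    fun h => hA0 (Submodule.finrank_eq_zero.1 h)
  obtain ⟨T', hT', hext⟩ := exists_equivariant_extension ρ (S.rep k) A hA (T ∘ₗ e.toLinearMap)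
    fun g v => by
      have := hT g (e v)
      rw [LinearMap.comp_apply, LinearMap.comp_apply]
      refine Eq.trans ?_ this
      congr 1
      change e _ = e (A'.toRepresentation g (e.symm (e v)))
      rw [e.symm_apply_apply]
      rfl
  refine ⟨k, ⟨T', fun g => LinearMap.ext (hT' g)⟩, ?_⟩
  by_contra! h
  refine hT0 (LinearMap.ext fun y => ?_)
  have h1 := h (e.symm y) (e.symm y).2
  have h2 := hext (e.symm y)
  rw [LinearMap.comp_apply, LinearEquiv.coe_coe, e.apply_symm_apply] at h2
  rw [← h2]
  exact h1

/-- Bases of the spaces of intertwining maps to all simple representations decompose a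
representation into simple summands. -/
theorem SimpleReps.bijective_of_bases [Finite I] {V : Type} [AddCommGroup V] [Module ℂ V]
    [FiniteDimensional ℂ V] (ρ : Representation ℂ G V) (n : I → ℕ)
    (b : ∀ k, Module.Basis (Fin (n k)) ℂ (ρ.IntertwiningMap (S.rep k))) :
    Function.Bijective (fun (v : V) (k : I) (s : Fin (n k)) => b k s v) := by
  classical
  have := Fintype.ofFinite G
  have := Fintype.ofFinite I
  let Φ : V →ₗ[ℂ] ∀ k, Fin (n k) → S.U k :=
    LinearMap.pi fun k => LinearMap.pi fun s => (b k s).toLinearMap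
  have hΦ : ∀ v k s, Φ v k s = b k s v := fun _ _ _ => rfl
  change Function.Bijective Φ
  constructor
  -- A nonzero kernel would be detected by some intertwining map to a simple representation. That
  -- map is a combination of the basis maps, which all vanish on the kernel.
  · rw [← LinearMap.ker_eq_bot]
    by_contra hne
    obtain ⟨k, T, v, hv, hTv⟩ := S.exists_equivariant_ne_zero ρ (LinearMap.ker Φ)
      (fun g v hv => by
        rw [LinearMap.mem_ker] at hv ⊢
        funext k s
        rw [hΦ, (b k s).isIntertwining, ← hΦ, hv]
        simp) hne
    apply hTv
    rw [← (b k).sum_repr T, Representation.IntertwiningMap.sum_apply]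
    refine Finset.sum_eq_zero fun s _ => ?_
    rw [Representation.IntertwiningMap.smul_apply, ← hΦ, LinearMap.mem_ker.1 hv]
    simp
  · rw [← LinearMap.range_eq_top]
    by_contra hne
    obtain ⟨l, hl0, hl⟩ := Submodule.exists_le_ker_of_lt_top _ (lt_top_iff_ne_top.2 hne)
    have hl' : ∀ v, l (Φ v) = 0 := fun v => hl ⟨v, rfl⟩
    have hsum : ∀ y : ∀ k, Fin (n k) → S.U k, l y = ∑ k, ∑ s, l (Pi.single k (Pi.single s (y k s))) := by
      intro y
      conv_lhs => rw [← Finset.univ_sum_single y]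
      rw [map_sum]
      refine Finset.sum_congr rfl fun k _ => ?_
      conv_lhs => rw [← Finset.univ_sum_single (y k), ← LinearMap.single_apply ℂ, map_sum, map_sum]
      rfl
    -- the components of `l`
    let c : ∀ k, Fin (n k) → Module.Dual ℂ (S.U k) := fun k s =>
      l ∘ₗ LinearMap.single ℂ (fun k => Fin (n k) → S.U k) k ∘ₗ
        LinearMap.single ℂ (fun _ : Fin (n k) => S.U k) s
    have hc : ∀ y, l y = ∑ k, ∑ s, c k s (y k s) := hsum
    apply hl0
    refine LinearMap.ext fun y => ?_
    rw [hc, LinearMap.zero_apply]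
    refine Finset.sum_eq_zero fun j _ => Finset.sum_eq_zero fun t _ => ?_
    suffices h : ∀ z, c j t z = 0 from h _
    intro z
    -- Averaging turns the form `l`, which vanishes on the image, into equivariant maps with `∑ T k
    -- s ∘ b k s = 0`. By Schur this is a linear relation among the `b j s`, so its coefficients are
    -- zero.
    let T : ∀ k, Fin (n k) → (S.U k →ₗ[ℂ] S.U j) := fun k s =>
      sumConj (S.rep k) (S.rep j) ((c k s).smulRight z)
    have hT : ∀ v, ∑ k, ∑ s, T k s (b k s v) = 0 := by
      intro v
      simp only [T, sumConj_apply, LinearMap.smulRight_apply, ← (b _ _).isIntertwining]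
      simp_rw [Finset.sum_comm (s := Finset.univ (α := Fin (n _)))]
      rw [Finset.sum_comm]
      refine Finset.sum_eq_zero fun g _ => ?_
      have := hl' (ρ g⁻¹ v)
      rw [hc] at this
      simp only [← map_sum, ← Finset.sum_smul]
      simp only [hΦ] at this
      rw [this, zero_smul, map_zero]
    have hTj : ∀ s, ∃ a : ℂ, T j s = a • LinearMap.id := fun s =>
      S.eq_smul_id j _ (sumConj_equivariant (S.rep j) (S.rep j) _)
    choose a ha using hTj
    have hTk : ∀ k s, k ≠ j → T k s = 0 := fun k s hk =>
      S.eq_zero_of_ne hk _ (sumConj_equivariant (S.rep k) (S.rep j) _)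
    have hlin : ∑ s, a s • b j s = 0 := by
      refine Representation.IntertwiningMap.ext (LinearMap.ext fun v => ?_)
      have := hT v
      rw [Finset.sum_eq_single_of_mem j (Finset.mem_univ _) fun k _ hk =>
        Finset.sum_eq_zero fun s _ => by rw [hTk k s hk, LinearMap.zero_apply]] at this
      simp only [ha, LinearMap.smul_apply, LinearMap.id_apply] at this
      rw [Representation.IntertwiningMap.toLinearMap_apply,
        Representation.IntertwiningMap.sum_apply]
      exact this
    have ha0 : a t = 0 := Fintype.linearIndependent_iff.1 (b j).linearIndependent a hlin t
    -- The trace of the averaged rank-one map recovers `c j t z`.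
    have htr : LinearMap.trace ℂ (S.U j) (T j t) = Fintype.card G * c j t z := by
      have h1 : ∀ g : G, LinearMap.trace ℂ (S.U j)
          (S.rep j g ∘ₗ (c j t).smulRight z ∘ₗ S.rep j g⁻¹) = c j t z := by
        intro g
        rw [LinearMap.trace_comp_comm', LinearMap.comp_assoc, ← Module.End.mul_eq_comp (S.rep j g⁻¹),
          ← map_mul, inv_mul_cancel, map_one]
        exact LinearMap.trace_smulRight (c j t) z
      simp only [T, sumConj, map_sum, h1]
      simp
    rw [ha, ha0, zero_smul, map_zero] at htr
    have hcard : (Fintype.card G : ℂ) ≠ 0 := Nat.cast_ne_zero.2 Fintype.card_ne_zero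
    exact (mul_eq_zero.1 htr.symm).resolve_left hcard

/-- Bases of the spaces of intertwining maps from the tensor products to the simple
representations. -/
abbrev SimpleReps.Bases : Type := ∀ i j k,
  Module.Basis (Fin (S.cg i j k)) ℂ (((S.rep i).tprod (S.rep j)).IntertwiningMap (S.rep k))

/-- The Clebsch-Gordan datum whose components are given intertwining maps. -/
def SimpleReps.datumOfBases (b : S.Bases) : CGDatum S := fun i j =>
  TensorProduct.curry (LinearMap.pi fun k => LinearMap.pi fun s => (b i j k s).toLinearMap)

omit [Finite G] in
theorem SimpleReps.datumOfBases_apply (b : S.Bases) (i j : I) (u : S.U i) (v : S.U j) (k : I)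
    (s : Fin (S.cg i j k)) : S.datumOfBases b i j u v k s = b i j k s (u ⊗ₜ v) := rfl

theorem SimpleReps.isRegular_datumOfBases [Finite I] (b : S.Bases)
    (hl : ∀ i s u, b S.zero i i s (S.one ⊗ₜ u) = u)
    (hr : ∀ i s u, b i S.zero i s (u ⊗ₜ S.one) = u) : IsRegular S (S.datumOfBases b) where
  bijective i j := by
    have h := S.bijective_of_bases ((S.rep i).tprod (S.rep j)) (S.cg i j) (b i j)
    convert h using 1
    funext w
    have : TensorProduct.lift (S.datumOfBases b i j) =
        LinearMap.pi fun k => LinearMap.pi fun s => (b i j k s).toLinearMap :=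
      TensorProduct.ext' fun u v => rfl
    rw [this]
    rfl
  equivariant g i j u v k s := by
    simp only [datumOfBases_apply]
    rw [← (b i j k s).isIntertwining, Representation.tprod_apply, TensorProduct.map_tmul]
  zero_left i u s := hl i s u
  zero_right i u s := hr i s u

theorem exists_basis_of_finrank_le_one {H : Type*} [AddCommGroup H] [Module ℂ H]
    [FiniteDimensional ℂ H] (h : Module.finrank ℂ H ≤ 1) (v : H) (hv : Module.finrank ℂ H ≠ 0 → v ≠ 0) :
    ∃ b : Module.Basis (Fin (Module.finrank ℂ H)) ℂ H, ∀ s, b s = v := by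
  rcases Nat.le_one_iff_eq_zero_or_eq_one.1 h with h0 | h1
  · exact ⟨Module.finBasis ℂ H, fun s => by
      have := s.2
      lia⟩
  · have hli : LinearIndependent ℂ (fun _ : Fin (Module.finrank ℂ H) => v) := by
      rw [h1]
      exact LinearIndependent.of_subsingleton 0 (hv (by lia))
    have : Nonempty (Fin (Module.finrank ℂ H)) := ⟨⟨0, by lia⟩⟩
    exact ⟨basisOfLinearIndependentOfCardEqFinrank hli (by simp), fun s => by simp⟩

end Regular

end ClebschGordan

namespace ClebschGordan

/-! ### Groups with one-dimensional simple representations -/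

section Characters

variable {G : Type} [Group G] {I : Type} {S : SimpleReps G I}

theorem SimpleReps.exists_character {i : I} (hi : S.dim i = 1) :
    ∃ χ : G → ℂ, ∀ g u, S.rep i g u = χ g • u := by
  have : Subsingleton (Fin (S.dim i)) := by rw [hi]; infer_instance
  let c : Fin (S.dim i) := ⟨0, by lia⟩
  refine ⟨fun g => S.rep i g (fun _ => 1) c, fun g u => ?_⟩
  have hu : u = u c • fun _ => 1 := by
    funext d
    rw [Subsingleton.elim d c]
    simp
  conv_lhs => rw [hu, map_smul]
  funext d
  rw [Subsingleton.elim d c]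
  simp [mul_comm]

/-- The multiplication of one-dimensional spaces of columns. -/
def mulMap (hS : ∀ i, S.dim i = 1) (i j k : I) : S.U i ⊗[ℂ] S.U j →ₗ[ℂ] S.U k :=
  TensorProduct.lift (LinearMap.mk₂ ℂ
    (fun u v _ => u ⟨0, by simp [hS]⟩ * v ⟨0, by simp [hS]⟩)
    (fun u u' v => by funext; simp [add_mul]) (fun c u v => by funext; simp [mul_assoc])
    (fun u v v' => by funext; simp [mul_add]) (fun c u v => by funext; simp [mul_left_comm]))

theorem mulMap_tmul (hS : ∀ i, S.dim i = 1) (i j k : I) (u : S.U i) (v : S.U j) :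
    mulMap hS i j k (u ⊗ₜ v) = fun _ => u ⟨0, by simp [hS]⟩ * v ⟨0, by simp [hS]⟩ := rfl

theorem mulMap_ne_zero (hS : ∀ i, S.dim i = 1) (i j k : I) : mulMap hS i j k ≠ 0 := fun h => by
  have := congrFun (LinearMap.congr_fun h ((fun _ => 1) ⊗ₜ (fun _ => 1))) ⟨0, by simp [hS]⟩
  simp [mulMap_tmul] at this

variable [Finite G]

omit [Finite G] in
theorem cg_le_one (hS : ∀ i, S.dim i = 1) (i j k : I) : S.cg i j k ≤ 1 := by
  have := LinearMap.finrank_le_finrank_of_injective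
    (f := Representation.IntertwiningMap.toLinearMapl ((S.rep i).tprod (S.rep j)) (S.rep k))
    (Representation.IntertwiningMap.toLinearMap_injective _ _)
  refine this.trans ?_
  rw [Module.finrank_linearMap, Module.finrank_tensorProduct, Module.finrank_fin_fun,
    Module.finrank_fin_fun, Module.finrank_fin_fun, hS, hS, hS]

omit [Finite G] in
theorem cg_ne_zero_iff (hS : ∀ i, S.dim i = 1) {χ : I → G → ℂ}
    (hχ : ∀ i g u, S.rep i g u = χ i g • u) (i j k : I) :
    S.cg i j k ≠ 0 ↔ ∀ g, χ i g * χ j g = χ k g := by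
  constructor
  · intro h g
    have : Nontrivial (((S.rep i).tprod (S.rep j)).IntertwiningMap (S.rep k)) :=
      Module.nontrivial_of_finrank_pos (R := ℂ) (Nat.pos_of_ne_zero h)
    obtain ⟨T, hT⟩ := exists_ne (0 : ((S.rep i).tprod (S.rep j)).IntertwiningMap (S.rep k))
    obtain ⟨u, v, huv⟩ : ∃ u v, T (u ⊗ₜ v) ≠ 0 := by
      by_contra! h
      exact hT (Representation.IntertwiningMap.ext (TensorProduct.ext' fun u v => h u v))
    have h1 := Representation.IntertwiningMap.isIntertwining _ _ T g (u ⊗ₜ v)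
    rw [Representation.tprod_apply, TensorProduct.map_tmul, hχ, hχ, hχ,
      TensorProduct.smul_tmul_smul, map_smul] at h1
    exact smul_left_injective ℂ huv h1
  · intro h h0
    have : Subsingleton (((S.rep i).tprod (S.rep j)).IntertwiningMap (S.rep k)) :=
      Module.finrank_zero_iff.1 h0
    let T : ((S.rep i).tprod (S.rep j)).IntertwiningMap (S.rep k) := ⟨mulMap hS i j k, fun g =>
      TensorProduct.ext' fun u v => by
        simp only [LinearMap.comp_apply, Representation.tprod_apply, TensorProduct.map_tmul, hχ]
        rw [TensorProduct.smul_tmul_smul, map_smul, h]⟩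
    exact mulMap_ne_zero hS i j k
      (congrArg Representation.IntertwiningMap.toLinearMap (Subsingleton.elim T 0))

omit [Finite G] in
-- All components can be taken to be the multiplication of numbers. Paths then commute strictly, and
-- so the preprojective relations will hold.
theorem exists_mul_bases (hS : ∀ i, S.dim i = 1) : ∃ b : S.Bases, ∀ i j k s u v,
    b i j k s (u ⊗ₜ v) = fun _ => u ⟨0, by simp [hS]⟩ * v ⟨0, by simp [hS]⟩ := by
  choose χ hχ using fun i => S.exists_character (hS i)
  have : ∀ i j k, ∃ b : Module.Basis (Fin (S.cg i j k)) ℂ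
      (((S.rep i).tprod (S.rep j)).IntertwiningMap (S.rep k)),
      ∀ s u v, b s (u ⊗ₜ v) = fun _ => u ⟨0, by simp [hS]⟩ * v ⟨0, by simp [hS]⟩ := by
    intro i j k
    by_cases h : S.cg i j k = 0
    · exact ⟨Module.finBasis ℂ _, fun s => by
        have := s.2
        lia⟩
    · have h' := (cg_ne_zero_iff hS hχ i j k).1 h
      let T : ((S.rep i).tprod (S.rep j)).IntertwiningMap (S.rep k) := ⟨mulMap hS i j k, fun g =>
        TensorProduct.ext' fun u v => by
          simp only [LinearMap.comp_apply, Representation.tprod_apply, TensorProduct.map_tmul, hχ]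
          rw [TensorProduct.smul_tmul_smul, map_smul, h']⟩
      obtain ⟨b, hb⟩ := exists_basis_of_finrank_le_one (cg_le_one hS i j k) T fun _ h0 =>
        mulMap_ne_zero hS i j k (congrArg Representation.IntertwiningMap.toLinearMap h0)
      exact ⟨b, fun s u v => congrArg
        (fun T : ((S.rep i).tprod (S.rep j)).IntertwiningMap (S.rep k) => T (u ⊗ₜ v)) (hb s)⟩
  choose b hb using this
  exact ⟨b, hb⟩

omit [Finite G] in
theorem sum_cg_mul_dim [Fintype I] {φ : CGDatum S} (hφ : IsRegular S φ) (i j : I) :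
    ∑ k, S.cg i j k * S.dim k = S.dim i * S.dim j := by
  have := (LinearEquiv.ofBijective _ (hφ.bijective i j)).finrank_eq
  simpa [Module.finrank_pi_fintype] using this.symm

end Characters

/-! ### Regular data when `ℂ²` splits into two characters -/

section Reducible

variable {Γ : Subgroup (Matrix.SpecialLinearGroup (Fin 2) ℂ)} [Finite Γ] {I K : Type}
  {S : SimpleReps Γ I} {D : Decomposition S K}

omit [Finite Γ] in
-- `Γ` acts faithfully and diagonally on `ℂ²`, so it is abelian.
theorem dim_eq_one_of_reducible (hp : ∀ k, S.dim (D.p k) = 1) (i : I) : S.dim i = 1 := by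
  choose χ hχ using fun k => S.exists_character (hp k)
  have hcomm : ∀ g h : Γ, g * h = h * g := by
    intro g h
    have h1 : ∀ x, (g.1.1 * h.1.1).mulVec x = (h.1.1 * g.1.1).mulVec x := by
      intro x
      apply D.iso.injective
      funext k
      rw [← Matrix.mulVec_mulVec, ← Matrix.mulVec_mulVec]
      simp only [D.equivariant, hχ, smul_smul, mul_comm]
    exact Subtype.ext (Subtype.ext (Matrix.ext_of_mulVec_single fun n => h1 _))
  have : IsMulCommutative Γ := ⟨⟨hcomm⟩⟩
  simpa using Representation.IsIrreducible.finrank_eq_one_of_isMulCommutative (S.rep i)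

/-- A zero determinant gives the dependencies `y 1 • x = x 1 • y` and `y 0 • x = x 0 • y`. -/
theorem eq_zero_of_det_eq_zero {x y : Fin 2 → ℂ} (h : x 0 * y 1 - x 1 * y 0 = 0)
    (hli : ∀ a b : ℂ, a • x = b • y → a = 0 ∧ b = 0) : y = 0 := by
  have h1 := (hli (y 1) (x 1) (by
    funext n
    fin_cases n
    · simp only [Fin.zero_eta, Pi.smul_apply, smul_eq_mul]
      linear_combination h
    · exact mul_comm _ _)).1
  have h0 := (hli (y 0) (x 0) (by
    funext n
    fin_cases n
    · exact mul_comm _ _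
    · simp only [Fin.mk_one, Pi.smul_apply, smul_eq_mul]
      linear_combination -h)).1
  funext n
  fin_cases n
  · exact h0
  · exact h1

omit [Finite Γ] in
-- In a basis of eigenvectors the product of the two characters is the determinant of `g`.
theorem character_mul_eq_one (hp : ∀ k, S.dim (D.p k) = 1) {k₀ k₁ : K} (hne : k₀ ≠ k₁)
    {χ : I → Γ → ℂ} (hχ : ∀ i g u, S.rep i g u = χ i g • u) (g : Γ) :
    χ (D.p k₀) g * χ (D.p k₁) g = 1 := by
  classical
  let e : K → Fin 2 → ℂ := fun k => D.iso.symm (Pi.single k fun _ => 1)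
  have hge : ∀ k, g.1.1.mulVec (e k) = χ (D.p k) g • e k := by
    intro k
    apply D.iso.injective
    funext l
    rw [D.equivariant, map_smul, hχ]
    simp only [e, LinearEquiv.apply_symm_apply, Pi.smul_apply]
    rcases eq_or_ne l k with rfl | h
    · rfl
    · simp [h]
  have hdet : e k₀ 0 * e k₁ 1 - e k₀ 1 * e k₁ 0 ≠ 0 := by
    intro h
    have hval : ∀ k l : K, l ≠ k → D.iso (e k) l = 0 := fun k l hl => by simp [e, hl]
    have hval' : ∀ k, D.iso (e k) k = fun _ => 1 := fun k => by simp [e]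
    have hone : ∀ (k : K) (a : ℂ), (a • (fun _ => 1 : S.U (D.p k))) = 0 → a = 0 := fun k a ha => by
      simpa using congrFun ha ⟨0, by simp [hp]⟩
    have h0 := eq_zero_of_det_eq_zero h fun a b hab => by
      have h1 := congrArg D.iso hab
      simp only [map_smul] at h1
      have h2 := congrFun h1 k₀
      have h3 := congrFun h1 k₁
      simp only [Pi.smul_apply, hval', hval k₀ k₁ hne.symm, hval k₁ k₀ hne, smul_zero] at h2 h3
      exact ⟨hone _ _ h2, hone _ _ h3.symm⟩
    have h4 := hval' k₁
    rw [h0, map_zero] at h4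
    have := congrFun h4 ⟨0, by simp [hp]⟩
    simp at this
  have h0 := hge k₀
  have h1 := hge k₁
  have h00 := congrFun h0 0
  have h01 := congrFun h0 1
  have h10 := congrFun h1 0
  have h11 := congrFun h1 1
  simp only [Matrix.mulVec, dotProduct, Fin.sum_univ_two, Pi.smul_apply, smul_eq_mul] at h00 h01 h10 h11
  have hg := g.1.2
  rw [Matrix.det_fin_two] at hg
  have key : (χ (D.p k₀) g * χ (D.p k₁) g - 1) * (e k₀ 0 * e k₁ 1 - e k₀ 1 * e k₁ 0) = 0 := by
    have e1 : (χ (D.p k₀) g * χ (D.p k₁) g) * (e k₀ 0 * e k₁ 1 - e k₀ 1 * e k₁ 0) =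
        (χ (D.p k₀) g * e k₀ 0) * (χ (D.p k₁) g * e k₁ 1) -
          (χ (D.p k₀) g * e k₀ 1) * (χ (D.p k₁) g * e k₁ 0) := by ring
    rw [sub_mul, e1, ← h00, ← h01, ← h10, ← h11]
    linear_combination (e k₀ 0 * e k₁ 1 - e k₀ 1 * e k₁ 0) * hg
  exact sub_eq_zero.1 ((mul_eq_zero.1 key).resolve_right hdet)

variable [Fintype I] [Fintype K]

/-- The existence of a preprojective regular datum when `ℂ²` is a sum of two characters. -/
theorem exists_preprojective_of_reducible (hp : ∀ k, S.dim (D.p k) = 1) {k₀ k₁ : K}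
    (hne : k₀ ≠ k₁) (hK : ∀ k, k = k₀ ∨ k = k₁) :
    ∃ (Q : KleinianQuiver S D) (φ : CGDatum S), IsRegular S φ ∧
      ∀ x, comparison S D (φ, x) ∈ preprojectiveRep S D Q := by
  classical
  have hS := dim_eq_one_of_reducible hp
  have hsub : ∀ i, Subsingleton (Fin (S.dim i)) := fun i => by rw [hS]; infer_instance
  choose χ hχ using fun i => S.exists_character (hS i)
  obtain ⟨b, hb⟩ := exists_mul_bases hS
  have hφ : IsRegular S (S.datumOfBases b) := by
    refine S.isRegular_datumOfBases b (fun i s u => ?_) fun i s u => ?_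
    · rw [hb]
      funext c
      simp only [SimpleReps.one, one_mul]
      exact congrArg u (Subsingleton.elim _ _)
    · rw [hb]
      funext c
      simp only [SimpleReps.one, mul_one]
      exact congrArg u (Subsingleton.elim _ _)
  -- The two characters are inverse to each other, so an arrow from `i` to `j` with label `k` is
  -- matched by one from `j` to `i` with the other label. `Q` consists of the arrows with label
  -- `k₀`.
  let σ : Equiv.Perm K := Equiv.swap k₀ k₁
  have hσσ : ∀ k, σ (σ k) = k := Equiv.swap_apply_self k₀ k₁
  have hχσ : ∀ k g, χ (D.p k) g * χ (D.p (σ k)) g = 1 := by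
    intro k g
    rcases hK k with rfl | rfl
    · simpa [σ] using character_mul_eq_one hp hne hχ g
    · simpa [σ] using character_mul_eq_one hp hne.symm hχ g
  have hcg1 : ∀ i j k, S.cg i (D.p k) j ≠ 0 → S.cg j (D.p (σ k)) i ≠ 0 := by
    intro i j k h
    rw [cg_ne_zero_iff hS hχ] at h ⊢
    intro g
    rw [← h g, mul_assoc, hχσ, mul_one]
  have hcg : ∀ i j k, S.cg i (D.p k) j = S.cg j (D.p (σ k)) i := by
    intro i j k
    have h1 := hcg1 i j k
    have h2 := hcg1 j i (σ k)
    rw [hσσ] at h2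
    have h3 := cg_le_one hS i (D.p k) j
    have h4 := cg_le_one hS j (D.p (σ k)) i
    lia
  let Q : KleinianQuiver S D :=
    { star := fun {i j} a => ⟨σ a.1, Fin.cast (hcg i j a.1) a.2⟩
      star_star := fun {i j} a => by
        refine Sigma.ext (hσσ a.1) ?_
        rw [Fin.heq_ext_iff (congrArg (fun k => S.cg i (D.p k) j) (hσσ a.1))]
        rfl
      pos := fun a => decide (a.1 = k₀)
      pos_star := fun a => by
        rcases hK a.1 with h | h <;> simp [h, σ, hne.symm] }
  refine ⟨Q, S.datumOfBases b, hφ, fun x => ?_⟩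
  rw [mem_preprojectiveRep_iff]
  intro v
  refine LinearMap.ext fun u => ?_
  let y : K → ℂ := fun k => D.iso x k ⟨0, by simp [hS]⟩
  have hterm : ∀ j (a : Arrow S D v j), Q.sign a • comparison S D (S.datumOfBases b, x) j v
      (Q.star a) (comparison S D (S.datumOfBases b, x) v j a u) =
      ((if a.1 = k₀ then (1 : ℂ) else -1) * (y a.1 * y (σ a.1))) • u := by
    intro j a
    rw [mul_smul]
    congr 1
    · simp [KleinianQuiver.sign, Q]
    · simp only [comparison_apply, S.datumOfBases_apply, hb]
      funext c
      rw [Subsingleton.elim c ⟨0, by simp [hS]⟩]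
      simp only [Pi.smul_apply, smul_eq_mul, y, Q]
      ring
  rw [relation_apply]
  simp only [hterm]
  -- Exactly one arrow of each label leaves `v`, so the relation reads `y k₀ * y k₁ - y k₁ * y k₀ =
  -- 0`.
  have hcount : ∀ k, ∑ j, S.cg v (D.p k) j = 1 := by
    intro k
    simpa [hS] using sum_cg_mul_dim hφ v (D.p k)
  have huniv : (Finset.univ : Finset K) = {k₀, k₁} := by
    ext k
    simpa using hK k
  have hinner : ∀ j, ∑ a : Arrow S D v j, ((if a.1 = k₀ then (1 : ℂ) else -1) *
      (y a.1 * y (σ a.1))) • u = ∑ k, S.cg v (D.p k) j • (((if k = k₀ then (1 : ℂ) else -1) *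
      (y k * y (σ k))) • u) := by
    intro j
    rw [Fintype.sum_sigma]
    simp
  simp only [hinner]
  rw [Finset.sum_comm]
  simp only [← Finset.sum_smul, hcount, one_smul]
  rw [huniv, Finset.sum_pair hne]
  simp [σ, hne.symm, mul_comm]

end Reducible

end ClebschGordan

namespace ClebschGordan

/-! ### The symplectic pairing of intertwining maps -/

section Pairing

variable {Γ : Subgroup (Matrix.SpecialLinearGroup (Fin 2) ℂ)} {I : Type} {S : SimpleReps Γ I}
  {p : I} (τ : (Fin 2 → ℂ) ≃ₗ[ℂ] S.U p)

/-- The standard symplectic form on the plane. -/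
def planeForm : (Fin 2 → ℂ) →ₗ[ℂ] (Fin 2 → ℂ) →ₗ[ℂ] ℂ :=
  LinearMap.mk₂ ℂ (fun x y => x 0 * y 1 - x 1 * y 0)
    (fun x x' y => by simp only [Pi.add_apply]; ring)
    (fun c x y => by simp only [Pi.smul_apply, smul_eq_mul]; ring)
    (fun x y y' => by simp only [Pi.add_apply]; ring)
    (fun c x y => by simp only [Pi.smul_apply, smul_eq_mul]; ring)

theorem planeForm_apply (x y : Fin 2 → ℂ) : planeForm x y = x 0 * y 1 - x 1 * y 0 := rfl

theorem planeForm_mulVec (g : Matrix.SpecialLinearGroup (Fin 2) ℂ) (x y : Fin 2 → ℂ) :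
    planeForm (g.1.mulVec x) (g.1.mulVec y) = planeForm x y := by
  have hg := g.2
  rw [Matrix.det_fin_two] at hg
  simp only [planeForm_apply, Matrix.mulVec, dotProduct, Fin.sum_univ_two]
  linear_combination (x 0 * y 1 - x 1 * y 0) * hg

/-- The contraction of a tensor with a vector of the plane through the symplectic form. -/
def contract (i : I) : S.U i ⊗[ℂ] S.U p →ₗ[ℂ] (Fin 2 → ℂ) →ₗ[ℂ] S.U i :=
  TensorProduct.lift (LinearMap.mk₂ ℂ (fun u w => (planeForm (τ.symm w)).smulRight u)
    (fun u u' w => by refine LinearMap.ext fun x => ?_; simp)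
    (fun c u w => LinearMap.ext fun x => smul_comm _ c u)
    (fun u w w' => by refine LinearMap.ext fun x => ?_; simp [add_smul])
    (fun c u w => by refine LinearMap.ext fun x => ?_; simp [mul_smul]))

theorem contract_tmul (i : I) (u : S.U i) (w : S.U p) (x : Fin 2 → ℂ) :
    contract τ i (u ⊗ₜ w) x = planeForm (τ.symm w) x • u := rfl

/-- This is the expansion in a symplectic basis. A tensor is therefore determined by its
contractions. -/
theorem eq_contract (i : I) (w : S.U i ⊗[ℂ] S.U p) :
    contract τ i w (Pi.single 1 1) ⊗ₜ τ (Pi.single 0 1) -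
      contract τ i w (Pi.single 0 1) ⊗ₜ τ (Pi.single 1 1) = w := by
  induction w with
  | zero => simp
  | add w w' h h' =>
    conv_rhs => rw [← h, ← h']
    simp only [map_add, LinearMap.add_apply, TensorProduct.add_tmul]
    abel
  | tmul u y =>
    obtain ⟨x, rfl⟩ := τ.surjective y
    simp only [contract_tmul, planeForm_apply, LinearEquiv.symm_apply_apply, Pi.single_eq_same]
    have hx : x = x 0 • Pi.single 0 1 + x 1 • Pi.single 1 1 := by
      funext n
      fin_cases n <;> simp
    conv_rhs => rw [hx, map_add, map_smul, map_smul, TensorProduct.tmul_add,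
      TensorProduct.tmul_smul, TensorProduct.tmul_smul]
    simp [TensorProduct.smul_tmul', sub_eq_add_neg, TensorProduct.neg_tmul]

variable {τ} in
theorem contract_rep (hτ : ∀ (g : Γ) x, τ (g.1.1.mulVec x) = S.rep p g (τ x)) (i : I) (g : Γ)
    (w : S.U i ⊗[ℂ] S.U p) (x : Fin 2 → ℂ) :
    contract τ i ((S.rep i).tprod (S.rep p) g w) (g.1.1.mulVec x) =
      S.rep i g (contract τ i w x) := by
  induction w with
  | zero => simp
  | add w w' h h' => simp only [map_add, LinearMap.add_apply, h, h']
  | tmul u y =>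
    obtain ⟨y, rfl⟩ := τ.surjective y
    rw [Representation.tprod_apply, TensorProduct.map_tmul, ← hτ, contract_tmul, contract_tmul,
      LinearEquiv.symm_apply_apply, LinearEquiv.symm_apply_apply, planeForm_mulVec, map_smul]

/-- The adjoint `U j → U i ⊗ U p` of an intertwining map `U j ⊗ U p → U i`. -/
def sharp (i j : I) : ((S.rep j).tprod (S.rep p)).IntertwiningMap (S.rep i) →ₗ[ℂ]
    S.U j →ₗ[ℂ] S.U i ⊗[ℂ] S.U p :=
  LinearMap.mk₂ ℂ (fun f z => f (z ⊗ₜ τ (Pi.single 1 1)) ⊗ₜ τ (Pi.single 0 1) -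
      f (z ⊗ₜ τ (Pi.single 0 1)) ⊗ₜ τ (Pi.single 1 1))
    (fun f f' z => by
      change (f _ + f' _) ⊗ₜ[ℂ] _ - (f _ + f' _) ⊗ₜ[ℂ] _ = _
      simp only [TensorProduct.add_tmul]
      abel)
    (fun c f z => by
      simp only [Representation.IntertwiningMap.smul_apply, TensorProduct.smul_tmul', smul_sub])
    (fun f z z' => by simp only [TensorProduct.add_tmul, map_add]; abel)
    (fun c f z => by
      simp only [map_smul, smul_sub, ← TensorProduct.smul_tmul'])

theorem sharp_apply {i j : I} (f : ((S.rep j).tprod (S.rep p)).IntertwiningMap (S.rep i))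
    (z : S.U j) : sharp τ i j f z = f (z ⊗ₜ τ (Pi.single 1 1)) ⊗ₜ τ (Pi.single 0 1) -
      f (z ⊗ₜ τ (Pi.single 0 1)) ⊗ₜ τ (Pi.single 1 1) := rfl

theorem contract_sharp {i j : I} (f : ((S.rep j).tprod (S.rep p)).IntertwiningMap (S.rep i))
    (z : S.U j) (x : Fin 2 → ℂ) : contract τ i (sharp τ i j f z) x = f (z ⊗ₜ τ x) := by
  have hx : x = x 0 • Pi.single 0 1 + x 1 • Pi.single 1 1 := by
    funext n
    fin_cases n <;> simp
  conv_rhs => rw [hx, map_add, map_smul, map_smul, TensorProduct.tmul_add,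
    TensorProduct.tmul_smul, TensorProduct.tmul_smul, map_add, map_smul, map_smul]
  simp [sharp_apply, contract_tmul, planeForm_apply, add_comm]

variable {τ} in
theorem sharp_rep (hτ : ∀ (g : Γ) x, τ (g.1.1.mulVec x) = S.rep p g (τ x)) {i j : I}
    (f : ((S.rep j).tprod (S.rep p)).IntertwiningMap (S.rep i)) (g : Γ) (z : S.U j) :
    sharp τ i j f (S.rep j g z) = (S.rep i).tprod (S.rep p) g (sharp τ i j f z) := by
  have h : contract τ i (sharp τ i j f (S.rep j g z)) =
      contract τ i ((S.rep i).tprod (S.rep p) g (sharp τ i j f z)) := by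
    refine LinearMap.ext fun x => ?_
    obtain ⟨y, rfl⟩ : ∃ y, g.1.1.mulVec y = x :=
      ⟨g⁻¹.1.1.mulVec x, by
        rw [Matrix.mulVec_mulVec, ← Matrix.SpecialLinearGroup.coe_mul, ← Subgroup.coe_mul]
        simp⟩
    rw [contract_rep hτ, contract_sharp, contract_sharp, hτ, ← f.isIntertwining,
      Representation.tprod_apply, TensorProduct.map_tmul]
  rw [← eq_contract τ i (sharp τ i j f (S.rep j g z)), h, eq_contract]

/-- The trace pairing of the intertwining maps `U i ⊗ U p → U j` and `U j ⊗ U p → U i`. -/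
def tracePairing (i j : I) : ((S.rep i).tprod (S.rep p)).IntertwiningMap (S.rep j) →ₗ[ℂ]
    ((S.rep j).tprod (S.rep p)).IntertwiningMap (S.rep i) →ₗ[ℂ] ℂ :=
  LinearMap.mk₂ ℂ (fun f f' => LinearMap.trace ℂ (S.U j) (f.toLinearMap ∘ₗ sharp τ i j f'))
    (fun f f' z => by
      rw [← map_add, ← LinearMap.add_comp]; rfl)
    (fun c f z => by
      rw [← map_smul, ← LinearMap.smul_comp]; rfl)
    (fun f z z' => by rw [map_add, LinearMap.comp_add, map_add])
    (fun c f z => by rw [map_smul, LinearMap.comp_smul, map_smul])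

theorem tracePairing_apply {i j : I} (f : ((S.rep i).tprod (S.rep p)).IntertwiningMap (S.rep j))
    (f' : ((S.rep j).tprod (S.rep p)).IntertwiningMap (S.rep i)) : tracePairing τ i j f f' =
      LinearMap.trace ℂ (S.U j) (f.toLinearMap ∘ₗ sharp τ i j f') := rfl

/-- The composite `f ∘ sharp f'` is an alternating sum over the two basis vectors of the plane, and
cyclicity of the trace exchanges the factors. This sign is the one in the preprojective relations.
-/
theorem tracePairing_comm {i j : I} (f : ((S.rep i).tprod (S.rep p)).IntertwiningMap (S.rep j))
    (f' : ((S.rep j).tprod (S.rep p)).IntertwiningMap (S.rep i)) :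
    tracePairing τ j i f' f = -tracePairing τ i j f f' := by
  have key : ∀ (i j : I) (f : ((S.rep i).tprod (S.rep p)).IntertwiningMap (S.rep j))
      (f' : ((S.rep j).tprod (S.rep p)).IntertwiningMap (S.rep i)),
      f.toLinearMap ∘ₗ sharp τ i j f' =
        (TensorProduct.curry f.toLinearMap).flip (τ (Pi.single 0 1)) ∘ₗ
          (TensorProduct.curry f'.toLinearMap).flip (τ (Pi.single 1 1)) -
        (TensorProduct.curry f.toLinearMap).flip (τ (Pi.single 1 1)) ∘ₗ
          (TensorProduct.curry f'.toLinearMap).flip (τ (Pi.single 0 1)) := by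
    intro i j f f'
    refine LinearMap.ext fun z => ?_
    simp [sharp_apply]
  rw [tracePairing_apply, tracePairing_apply, key, key, map_sub, map_sub,
    LinearMap.trace_comp_comm', LinearMap.trace_comp_comm' _
      ((TensorProduct.curry f'.toLinearMap).flip (τ (Pi.single 1 1)))]
  ring

variable {τ}

theorem smul_comp_sharp (hτ : ∀ (g : Γ) x, τ (g.1.1.mulVec x) = S.rep p g (τ x)) {i j : I}
    (f : ((S.rep i).tprod (S.rep p)).IntertwiningMap (S.rep j))
    (f' : ((S.rep j).tprod (S.rep p)).IntertwiningMap (S.rep i)) (z : S.U j) :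
    (S.dim j : ℂ) • f (sharp τ i j f' z) = tracePairing τ i j f f' • z := by
  obtain ⟨c, hc⟩ := S.eq_smul_id j (f.toLinearMap ∘ₗ sharp τ i j f') fun g u => by
    rw [LinearMap.comp_apply, LinearMap.comp_apply, sharp_rep hτ]
    exact f.isIntertwining _ _ g _
  have h1 : f (sharp τ i j f' z) = c • z := LinearMap.congr_fun hc z
  rw [tracePairing_apply, hc, map_smul, LinearMap.trace_id, h1, Module.finrank_fin_fun, smul_smul,
    smul_eq_mul, mul_comm]

theorem apply_sharp_eq_zero (hτ : ∀ (g : Γ) x, τ (g.1.1.mulVec x) = S.rep p g (τ x)) {i j k : I}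
    (hjk : j ≠ k) (f : ((S.rep i).tprod (S.rep p)).IntertwiningMap (S.rep k))
    (f' : ((S.rep j).tprod (S.rep p)).IntertwiningMap (S.rep i)) (z : S.U j) :
    f (sharp τ i j f' z) = 0 :=
  LinearMap.congr_fun (S.eq_zero_of_ne hjk (f.toLinearMap ∘ₗ sharp τ i j f') fun g u => by
    rw [LinearMap.comp_apply, LinearMap.comp_apply, sharp_rep hτ]
    exact f.isIntertwining _ _ g _) z

variable [Finite Γ]

/-- The map `f` is surjective onto a simple representation. The averaged section `s'` is `sharp` of
its own contraction `f'`, and `f ∘ s'` is the scalar `|Γ|`, whose trace is nonzero. -/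
theorem exists_tracePairing_ne_zero (hτ : ∀ (g : Γ) x, τ (g.1.1.mulVec x) = S.rep p g (τ x))
    {i j : I} (f : ((S.rep i).tprod (S.rep p)).IntertwiningMap (S.rep j)) (hf : f ≠ 0) :
    ∃ f', tracePairing τ i j f f' ≠ 0 := by
  have := Fintype.ofFinite Γ
  have hsurj := (Representation.IsIrreducible.surjective_or_eq_zero f).resolve_right hf
  obtain ⟨s, hs⟩ := LinearMap.exists_rightInverse_of_surjective f.toLinearMap
    (LinearMap.range_eq_top.2 hsurj)
  let σ := (S.rep i).tprod (S.rep p)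
  let s' := sumConj (S.rep j) σ s
  have hs' : ∀ z, f (s' z) = (Fintype.card Γ : ℂ) • z := by
    intro z
    have h1 : ∀ g : Γ, f (σ g (s (S.rep j g⁻¹ z))) = z := fun g => by
      rw [f.isIntertwining]
      have h2 : f (s (S.rep j g⁻¹ z)) = S.rep j g⁻¹ z := LinearMap.congr_fun hs _
      rw [h2, S.rep_rep_inv]
    simp only [s', sumConj_apply, map_sum, h1]
    simp [Nat.cast_smul_eq_nsmul]
  let f' : ((S.rep j).tprod (S.rep p)).IntertwiningMap (S.rep i) :=
    ⟨TensorProduct.lift ((contract τ i ∘ₗ s').compl₂ τ.symm.toLinearMap), fun g =>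
      TensorProduct.ext' fun z y => by
        obtain ⟨x, rfl⟩ := τ.surjective y
        simp only [LinearMap.comp_apply, Representation.tprod_apply, TensorProduct.map_tmul,
          TensorProduct.lift.tmul, LinearMap.compl₂_apply, ← hτ, LinearEquiv.coe_coe,
          LinearEquiv.symm_apply_apply]
        rw [← contract_rep hτ, ← sumConj_equivariant]⟩
  have hf' : ∀ z x, f' (z ⊗ₜ τ x) = contract τ i (s' z) x := fun z x => by
    change contract τ i (s' z) (τ.symm (τ x)) = _
    rw [LinearEquiv.symm_apply_apply]
  have hsharp : sharp τ i j f' = s' := by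
    refine LinearMap.ext fun z => ?_
    rw [sharp_apply, hf', hf', eq_contract]
  refine ⟨f', fun h0 => ?_⟩
  obtain ⟨z, hz⟩ := exists_ne (0 : S.U j)
  have h := smul_comp_sharp hτ f f' z
  rw [h0, hsharp, hs', zero_smul] at h
  have hd : (S.dim j : ℂ) ≠ 0 := fun hd => by
    have h1 : S.dim j = 0 := by exact_mod_cast hd
    exact hz (funext fun c => absurd c.2 (by lia))
  have hc : (Fintype.card Γ : ℂ) ≠ 0 := Nat.cast_ne_zero.2 Fintype.card_ne_zero
  exact hz ((smul_eq_zero.1 ((smul_eq_zero.1 h).resolve_left hd)).resolve_left hc)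

theorem tracePairing_isPerfPair (hτ : ∀ (g : Γ) x, τ (g.1.1.mulVec x) = S.rep p g (τ x))
    (i j : I) : (tracePairing τ i j).IsPerfPair := by
  refine LinearMap.IsPerfPair.of_injective ?_ ?_
  · rw [injective_iff_map_eq_zero]
    intro f hf
    by_contra h
    obtain ⟨f', hf'⟩ := exists_tracePairing_ne_zero hτ f h
    exact hf' (LinearMap.congr_fun hf f')
  · rw [injective_iff_map_eq_zero]
    intro f hf
    by_contra h
    obtain ⟨f', hf'⟩ := exists_tracePairing_ne_zero hτ f h
    rw [tracePairing_comm] at hf'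
    exact hf' (by simpa using LinearMap.congr_fun hf f')

theorem cg_symm (hτ : ∀ (g : Γ) x, τ (g.1.1.mulVec x) = S.rep p g (τ x)) (i j : I) :
    S.cg i p j = S.cg j p i := by
  have := tracePairing_isPerfPair hτ i j
  exact ((tracePairing τ i j).toPerfPair.finrank_eq).trans Subspace.dual_finrank_eq

theorem exists_dual_basis (hτ : ∀ (g : Γ) x, τ (g.1.1.mulVec x) = S.rep p g (τ x)) {i j : I}
    (b : Module.Basis (Fin (S.cg i p j)) ℂ
      (((S.rep i).tprod (S.rep p)).IntertwiningMap (S.rep j))) {c : ℂ} (hc : c ≠ 0) :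
    ∃ b' : Module.Basis (Fin (S.cg j p i)) ℂ
      (((S.rep j).tprod (S.rep p)).IntertwiningMap (S.rep i)), ∀ s t,
        tracePairing τ i j (b s) (b' (Fin.cast (cg_symm hτ i j) t)) = if s = t then c else 0 := by
  have := tracePairing_isPerfPair hτ i j
  refine ⟨((b.dualBasis.map (tracePairing τ i j).flip.toPerfPair.symm).map
    (LinearEquiv.smulOfNeZero ℂ _ c hc)).reindex (finCongr (cg_symm hτ i j)), fun s t => ?_⟩
  simp only [Module.Basis.reindex_apply, Module.Basis.map_apply, LinearEquiv.smulOfNeZero_apply,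
    map_smul, LinearMap.apply_toPerfPair_flip, finCongr_symm, finCongr_apply, Fin.cast_cast,
    Fin.cast_eq_self, Module.Basis.dualBasis_apply_self, smul_eq_mul, mul_ite, mul_one, mul_zero]

end Pairing

end ClebschGordan

namespace ClebschGordan

/-! ### The central element of a binary polyhedral group -/

section Central

variable {Γ : Subgroup (Matrix.SpecialLinearGroup (Fin 2) ℂ)} {I : Type} {S : SimpleReps Γ I}
  {p : I} {τ : (Fin 2 → ℂ) ≃ₗ[ℂ] S.U p}

/-- With trace zero, Cayley–Hamilton gives `g² = -1`. With nonzero trace, `g² = 1` kills the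
off-diagonal entries, and determinant `1` makes the diagonal ones equal. -/
theorem coe_eq_neg_one_of_mul_self {g : Matrix.SpecialLinearGroup (Fin 2) ℂ} (h : g * g = 1)
    (hg : g ≠ 1) : g.1 = -1 := by
  have h1 : g.1 * g.1 = 1 := congrArg Subtype.val h
  have hd := g.2
  rw [Matrix.det_fin_two] at hd
  have h00 := congrFun (congrFun h1 0) 0
  have h01 := congrFun (congrFun h1 0) 1
  have h10 := congrFun (congrFun h1 1) 0
  have h11 := congrFun (congrFun h1 1) 1
  simp only [Matrix.mul_apply, Fin.sum_univ_two, Matrix.one_apply_eq, ne_eq, zero_ne_one,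
    one_ne_zero, not_false_eq_true, Matrix.one_apply_ne] at h00 h01 h10 h11
  by_cases ht : g.1 0 0 + g.1 1 1 = 0
  · exfalso
    have : (2 : ℂ) = 0 := by linear_combination (g.1 0 0) * ht - h00 - hd
    norm_num at this
  have hb : g.1 0 1 = 0 :=
    (mul_eq_zero.1 (show (g.1 0 0 + g.1 1 1) * g.1 0 1 = 0 by linear_combination h01)).resolve_left ht
  have hc : g.1 1 0 = 0 :=
    (mul_eq_zero.1 (show (g.1 0 0 + g.1 1 1) * g.1 1 0 = 0 by linear_combination h10)).resolve_left ht
  rw [hb] at h00 hd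
  have had : g.1 1 1 = g.1 0 0 := by
    linear_combination (-g.1 1 1) * h00 + g.1 0 0 * hd
  have hsq : (g.1 0 0 - 1) * (g.1 0 0 + 1) = 0 := by linear_combination h00
  rcases mul_eq_zero.1 hsq with h0 | h0
  · refine absurd (Subtype.ext ?_) hg
    ext n m
    fin_cases n <;> fin_cases m
    · exact sub_eq_zero.1 h0
    · exact hb
    · exact hc
    · exact had.trans (sub_eq_zero.1 h0)
  · have h0 := eq_neg_of_add_eq_zero_left h0
    ext n m
    fin_cases n <;> fin_cases m
    · simpa using h0
    · simpa using hb
    · simpa using hc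
    · simpa using had.trans h0

theorem dim_eq_two (τ : (Fin 2 → ℂ) ≃ₗ[ℂ] S.U p) : S.dim p = 2 := by
  simpa using τ.finrank_eq.symm

theorem zero_ne_of_plane (τ : (Fin 2 → ℂ) ≃ₗ[ℂ] S.U p) : S.zero ≠ p := fun h => by
  have h1 := dim_eq_two τ
  have h2 := S.dim_zero
  rw [h] at h2
  lia

theorem character_eq_trace (hτ : ∀ (g : Γ) x, τ (g.1.1.mulVec x) = S.rep p g (τ x)) (g : Γ) :
    (S.rep p).character g = g.1.1.trace := by
  have h : S.rep p g = τ.conj (Matrix.toLin' g.1.1) := by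
    refine LinearMap.ext fun u => ?_
    obtain ⟨x, rfl⟩ := τ.surjective u
    rw [LinearEquiv.conj_apply_apply, LinearEquiv.symm_apply_apply, Matrix.toLin'_apply, hτ]
  rw [Representation.character, h, LinearMap.trace_conj', Matrix.trace_toLin'_eq]

/-- In even order an involution exists by Cauchy, and it can only be `-1`. In odd order squaring
permutes `Γ`, so `tr (g²)` sums to the same value as `tr g`, which is `0`. But `tr (g²) = (tr g)² -
2` sums to `|Γ| - 2 |Γ|` by orthonormality of characters. -/
theorem exists_coe_eq_neg_one [Finite Γ]
    (hτ : ∀ (g : Γ) x, τ (g.1.1.mulVec x) = S.rep p g (τ x)) : ∃ z : Γ, z.1.1 = -1 := by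
  have := Fintype.ofFinite Γ
  by_cases h2 : 2 ∣ Fintype.card Γ
  · obtain ⟨z, hz⟩ := exists_prime_orderOf_dvd_card 2 h2
    refine ⟨z, coe_eq_neg_one_of_mul_self ?_ ?_⟩
    · have := pow_orderOf_eq_one z
      rw [hz, pow_two] at this
      exact congrArg Subtype.val this
    · intro h
      rw [show z = 1 from Subtype.ext h, orderOf_one] at hz
      lia
  · exfalso
    have hc : (Nat.card Γ : ℂ) ≠ 0 := Nat.cast_ne_zero.2 Nat.card_pos.ne'
    have : Invertible (Nat.card Γ : ℂ) := invertibleOfNonzero hc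
    have hz := Representation.char_orthonormal (S.rep p) (S.rep S.zero)
    rw [if_neg fun h => zero_ne_of_plane τ (S.eq_of_equiv _ _ h)] at hz
    have hp := Representation.char_orthonormal (S.rep p) (S.rep p)
    rw [if_pos ⟨Representation.Equiv.refl _⟩] at hp
    have hchar0 : ∀ g, (S.rep S.zero).character g = 1 := fun g => by
      rw [Representation.character, S.rep_zero, LinearMap.trace_id, Module.finrank_fin_fun,
        S.dim_zero, Nat.cast_one]
    have hinv : ∀ g : Γ, (g⁻¹).1.1.trace = g.1.1.trace := fun g => by
      rw [Subgroup.coe_inv, Matrix.SpecialLinearGroup.coe_inv, Matrix.adjugate_fin_two,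
        Matrix.trace_fin_two, Matrix.trace_fin_two]
      simp [add_comm]
    simp only [hchar0, mul_one, character_eq_trace hτ, hinv] at hz hp
    have hz' := (mul_eq_zero.1 hz).resolve_left (inv_ne_zero hc)
    rw [inv_mul_eq_one₀ hc] at hp
    have hcop : (Nat.card Γ).Coprime 2 := by
      rw [Nat.card_eq_fintype_card, Nat.coprime_comm]
      exact (Nat.Prime.coprime_iff_not_dvd Nat.prime_two).2 h2
    have hsq := (powCoprime hcop).sum_comp fun g : Γ => g.1.1.trace
    have htr : ∀ g : Γ, (powCoprime hcop g).1.1.trace = g.1.1.trace * g.1.1.trace - 2 := by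
      intro g
      have hd := g.1.2
      rw [Matrix.det_fin_two] at hd
      have : (powCoprime hcop g).1.1 = g.1.1 * g.1.1 := by
        simp [powCoprime, pow_two]
      rw [this]
      simp only [Matrix.trace_fin_two, Matrix.mul_apply, Fin.sum_univ_two]
      linear_combination -2 * hd
    simp only [htr, Finset.sum_sub_distrib, ← hp, hz', Finset.sum_const, Finset.card_univ,
      ← Nat.card_eq_fintype_card, nsmul_eq_mul] at hsq
    exact hc (by linear_combination -hsq)

/-- The central element `-1` acts on `U i ⊗ U p` by the negative of its scalar on `U i`. So the
quiver has no loops, and any total order of the vertices orients it. -/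
theorem cg_self_eq_zero [Finite Γ]
    (hτ : ∀ (g : Γ) x, τ (g.1.1.mulVec x) = S.rep p g (τ x)) (i : I) : S.cg i p i = 0 := by
  obtain ⟨z, hz⟩ := exists_coe_eq_neg_one hτ
  have hcomm : ∀ g : Γ, z * g = g * z := fun g => Subtype.ext (Subtype.ext (by
    simp [hz]))
  obtain ⟨c, hc⟩ := S.eq_smul_id i (S.rep i z) fun g u => by
    rw [← Module.End.mul_apply, ← Module.End.mul_apply, ← map_mul, ← map_mul, hcomm]
  have hc' : ∀ u, S.rep i z u = c • u := fun u => LinearMap.congr_fun hc u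
  have hp : ∀ v, S.rep p z v = -v := fun v => by
    obtain ⟨x, rfl⟩ := τ.surjective v
    rw [← hτ, hz, Matrix.neg_mulVec, Matrix.one_mulVec, map_neg]
  have hc0 : c ≠ 0 := by
    rintro rfl
    obtain ⟨u, hu⟩ := exists_ne (0 : S.U i)
    have := S.rep_inv_rep i z u
    rw [hc', zero_smul, map_zero] at this
    exact hu this.symm
  have : Subsingleton (((S.rep i).tprod (S.rep p)).IntertwiningMap (S.rep i)) := by
    refine subsingleton_of_forall_eq 0 fun f => Representation.IntertwiningMap.ext
      (TensorProduct.ext' fun u v => ?_)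
    have h := f.isIntertwining _ _ z (u ⊗ₜ v)
    rw [Representation.tprod_apply, TensorProduct.map_tmul, hc', hc', hp, TensorProduct.tmul_neg,
      ← TensorProduct.smul_tmul', map_neg, map_smul, neg_eq_iff_add_eq_zero, ← two_smul ℂ] at h
    exact ((smul_eq_zero.1 ((smul_eq_zero.1 h).resolve_left two_ne_zero)).resolve_left hc0)
  exact Module.finrank_zero_of_subsingleton

end Central

/-! ### Bases compatible with the units -/

section Units

variable {G : Type} [Group G] {I : Type} (S : SimpleReps G I)

theorem SimpleReps.eq_smul_one (u : S.U S.zero) : u = u ⟨0, by simp [S.dim_zero]⟩ • S.one := by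
  have : Subsingleton (Fin (S.dim S.zero)) := by rw [S.dim_zero]; infer_instance
  funext c
  rw [Subsingleton.elim c ⟨0, by simp [S.dim_zero]⟩]
  simp [SimpleReps.one]

/-- The trivial representation is a left unit of the tensor product. -/
def SimpleReps.leftUnit (i : I) : ((S.rep S.zero).tprod (S.rep i)).IntertwiningMap (S.rep i) :=
  ⟨TensorProduct.lift (LinearMap.lsmul ℂ (S.U i) ∘ₗ
    (LinearMap.proj ⟨0, by simp [S.dim_zero]⟩ : S.U S.zero →ₗ[ℂ] ℂ)), fun g =>
    TensorProduct.ext' fun u v => by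
      simp [Representation.tprod_apply, S.rep_zero]⟩

theorem SimpleReps.leftUnit_tmul (i : I) (u : S.U i) : S.leftUnit i (S.one ⊗ₜ u) = u :=
  one_smul ℂ u

/-- The trivial representation is a right unit of the tensor product. -/
def SimpleReps.rightUnit (i : I) : ((S.rep i).tprod (S.rep S.zero)).IntertwiningMap (S.rep i) :=
  ⟨(S.leftUnit i).toLinearMap ∘ₗ (TensorProduct.comm ℂ _ _).toLinearMap, fun g =>
    TensorProduct.ext' fun u v => (S.leftUnit i).isIntertwining _ _ g (v ⊗ₜ u)⟩

theorem SimpleReps.rightUnit_tmul (i : I) (u : S.U i) : S.rightUnit i (u ⊗ₜ S.one) = u :=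
  S.leftUnit_tmul i u

theorem SimpleReps.exists_basis_leftUnit (i : I) : ∃ b : Module.Basis (Fin (S.cg S.zero i i)) ℂ
    (((S.rep S.zero).tprod (S.rep i)).IntertwiningMap (S.rep i)), ∀ s, b s = S.leftUnit i := by
  refine exists_basis_of_finrank_le_one (finrank_le_one (S.leftUnit i) fun f => ?_) _ fun _ h => ?_
  · obtain ⟨c, hc⟩ := S.eq_smul_id i (TensorProduct.curry f.toLinearMap S.one) fun g u => by
      have := f.isIntertwining _ _ g (S.one ⊗ₜ u)
      rw [Representation.tprod_apply, TensorProduct.map_tmul, S.rep_zero] at this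
      exact this
    refine ⟨c, Representation.IntertwiningMap.ext (TensorProduct.ext' fun a u => ?_)⟩
    rw [S.eq_smul_one a, ← TensorProduct.smul_tmul', map_smul, map_smul]
    congr 1
    refine Eq.trans ?_ (LinearMap.congr_fun hc u).symm
    exact congrArg (c • ·) (S.leftUnit_tmul i u)
  · obtain ⟨u, hu⟩ := exists_ne (0 : S.U i)
    have := S.leftUnit_tmul i u
    rw [h] at this
    exact hu this.symm

theorem SimpleReps.exists_basis_rightUnit (i : I) : ∃ b : Module.Basis (Fin (S.cg i S.zero i)) ℂ
    (((S.rep i).tprod (S.rep S.zero)).IntertwiningMap (S.rep i)), ∀ s, b s = S.rightUnit i := by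
  refine exists_basis_of_finrank_le_one (finrank_le_one (S.rightUnit i) fun f => ?_) _ fun _ h => ?_
  · obtain ⟨c, hc⟩ := S.eq_smul_id i ((TensorProduct.curry f.toLinearMap).flip S.one) fun g u => by
      have := f.isIntertwining _ _ g (u ⊗ₜ S.one)
      rw [Representation.tprod_apply, TensorProduct.map_tmul, S.rep_zero] at this
      exact this
    refine ⟨c, Representation.IntertwiningMap.ext (TensorProduct.ext' fun u a => ?_)⟩
    rw [S.eq_smul_one a, TensorProduct.tmul_smul, map_smul, map_smul]
    congr 1
    refine Eq.trans ?_ (LinearMap.congr_fun hc u).symm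
    exact congrArg (c • ·) (S.rightUnit_tmul i u)
  · obtain ⟨u, hu⟩ := exists_ne (0 : S.U i)
    have := S.rightUnit_tmul i u
    rw [h] at this
    exact hu this.symm

/-- The two unit conditions concern different spaces of intertwining maps, except when both factors
are trivial. There they agree, since `S.one` spans the trivial representation. -/
theorem SimpleReps.exists_unital_bases : ∃ b : S.Bases,
    (∀ i s u, b S.zero i i s (S.one ⊗ₜ u) = u) ∧ ∀ i s u, b i S.zero i s (u ⊗ₜ S.one) = u := by
  classical
  choose bl hbl using S.exists_basis_leftUnit
  choose br hbr using S.exists_basis_rightUnit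
  let b : S.Bases := fun i j k =>
    if h : S.zero = i ∧ j = k then
      h.1 ▸ h.2 ▸ bl j
    else if h : S.zero = j ∧ i = k then
      h.1 ▸ h.2 ▸ br i
    else Module.finBasis ℂ _
  have hb0 : ∀ i, b S.zero i i = bl i := fun i => dif_pos ⟨rfl, rfl⟩
  have hb1 : ∀ i, i ≠ S.zero → b i S.zero i = br i := fun i hi => by
    refine (dif_neg fun h => hi h.1.symm).trans ?_
    exact dif_pos ⟨rfl, rfl⟩
  have hl : ∀ i s u, b S.zero i i s (S.one ⊗ₜ u) = u := fun i s u => by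
    rw [hb0, hbl, S.leftUnit_tmul]
  refine ⟨b, hl, fun i s u => ?_⟩
  by_cases hi : i = S.zero
  · subst hi
    have h := hl S.zero s u
    rw [S.eq_smul_one u] at h ⊢
    rwa [TensorProduct.tmul_smul, TensorProduct.smul_tmul'] at h
  · rw [hb1 i hi, hbr, S.rightUnit_tmul]

end Units

end ClebschGordan

namespace ClebschGordan

/-! ### Existence of preprojective regular data -/

section Existence

variable {Γ : Subgroup (Matrix.SpecialLinearGroup (Fin 2) ℂ)} [Finite Γ] {I K : Type}
  {S : SimpleReps Γ I}

section Paired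

variable {p : I} {τ : (Fin 2 → ℂ) ≃ₗ[ℂ] S.U p}

omit [Finite Γ] in
theorem dim_ne_zero (i : I) : (S.dim i : ℂ) ≠ 0 := by
  obtain ⟨u, hu⟩ := exists_ne (0 : S.U i)
  exact fun hd => hu (funext fun c => absurd c.2 (by
    have h1 : S.dim i = 0 := by exact_mod_cast hd
    lia))

/-- Unital bases in which the bases of opposite spaces of intertwining maps are dual up to
scalars. -/
theorem exists_paired_bases (hτ : ∀ (g : Γ) x, τ (g.1.1.mulVec x) = S.rep p g (τ x))
    {r : I → ℕ} (hr : Function.Injective r) (hr0 : r S.zero = 0) : ∃ b : S.Bases,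
    (∀ i s u, b S.zero i i s (S.one ⊗ₜ u) = u) ∧ (∀ i s u, b i S.zero i s (u ⊗ₜ S.one) = u) ∧
    ∀ i j s t, tracePairing τ i j (b i p j s) (b j p i (Fin.cast (cg_symm hτ i j) t)) =
      (if r i < r j then 1 else -1) * if s = t then (S.dim i * S.dim j : ℂ) else 0 := by
  classical
  obtain ⟨b, hl, hr1⟩ := S.exists_unital_bases
  -- The normalization `dim i * dim k` makes the scalar in the completeness identity `sum_sharp_eq`
  -- independent of the intermediate vertex.
  choose d hd using fun i k => exists_dual_basis hτ (b i p k)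
    (mul_ne_zero (dim_ne_zero (S := S) i) (dim_ne_zero k))
  -- Only the bases of descending arrows are replaced by dual ones. The unit conditions survive
  -- because the trivial vertex is lowest in the order and differs from `p`.
  let b' : S.Bases := fun i j k => if h : p = j ∧ r k < r i then h.1 ▸ d k i else b i j k
  have hb' : ∀ i j k, ¬(p = j ∧ r k < r i) → b' i j k = b i j k := fun i j k h => dif_neg h
  have hb'' : ∀ i k, r k < r i → b' i p k = d k i := fun i k h => dif_pos ⟨rfl, h⟩
  have hpos : ∀ i j, r i < r j → ∀ s t,
      tracePairing τ i j (b' i p j s) (b' j p i (Fin.cast (cg_symm hτ i j) t)) =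
        if s = t then (S.dim i * S.dim j : ℂ) else 0 := fun i j hij s t => by
    rw [hb'' j i hij, hb' i p j fun h => lt_asymm hij h.2, hd]
  refine ⟨b', fun i s u => ?_, fun i s u => ?_, fun i j s t => ?_⟩
  · rw [hb' S.zero i i fun h => by have := h.2; lia, hl]
  · rw [hb' i S.zero i fun h => zero_ne_of_plane τ h.1.symm, hr1]
  · rcases lt_trichotomy (r i) (r j) with h | h | h
    · rw [if_pos h, one_mul, hpos i j h]
    · obtain rfl := hr h
      have h0 := cg_self_eq_zero hτ i
      exact absurd s.2 (by lia)
    · rw [if_neg h.not_gt, tracePairing_comm]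
      have := hpos j i h (Fin.cast (cg_symm hτ i j) t) (Fin.cast (cg_symm hτ i j) s)
      rw [Fin.cast_cast, Fin.cast_eq_self] at this
      rw [this, neg_one_mul, mul_comm (S.dim j : ℂ)]
      simp [Fin.ext_iff, eq_comm]

variable [Fintype I]

/-- This is the completeness identity for dual bases. It is checked on the components `b v p k t`,
which are jointly injective, and there Schur leaves only the terms with the same vertex and index.
-/
theorem sum_sharp_eq (hτ : ∀ (g : Γ) x, τ (g.1.1.mulVec x) = S.rep p g (τ x)) {b : S.Bases}
    {ε : I → I → ℂ} (hε : ∀ i j, ε i j * ε i j = 1)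
    (hb : ∀ i j s t, tracePairing τ i j (b i p j s) (b j p i (Fin.cast (cg_symm hτ i j) t)) =
      ε i j * if s = t then (S.dim i * S.dim j : ℂ) else 0) (v : I) (w : S.U v ⊗[ℂ] S.U p) :
    ∑ j, ∑ s, ε v j • sharp τ v j (b j p v (Fin.cast (cg_symm hτ v j) s)) (b v p j s w) =
      (S.dim v : ℂ) • w := by
  apply (S.bijective_of_bases _ _ (b v p)).1
  funext k t
  simp only [map_sum, map_smul]
  rw [Finset.sum_eq_single k (fun j _ hj => Finset.sum_eq_zero fun s _ => by
    rw [apply_sharp_eq_zero hτ hj, smul_zero]) (by simp)]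
  have h : ∀ s, ε v k • b v p k t
      (sharp τ v k (b k p v (Fin.cast (cg_symm hτ v k) s)) (b v p k s w)) =
      if t = s then (S.dim v : ℂ) • b v p k s w else 0 := by
    intro s
    have h1 := smul_comp_sharp hτ (b v p k t) (b k p v (Fin.cast (cg_symm hτ v k) s)) (b v p k s w)
    rw [hb] at h1
    refine smul_right_injective _ (dim_ne_zero (S := S) k) ?_
    simp only
    rw [smul_comm, h1, smul_smul, ← mul_assoc, hε, one_mul]
    split_ifs
    · rw [smul_smul, mul_comm]
    · rw [zero_smul, smul_zero]
  simp [h]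

end Paired

variable [Fintype I] [Fintype K] {D : Decomposition S K}

/-- The existence of a preprojective regular datum when `ℂ²` is simple. -/
theorem exists_preprojective_of_irreducible {k₀ : K} (hK : ∀ k, k = k₀) :
    ∃ (Q : KleinianQuiver S D) (φ : CGDatum S), IsRegular S φ ∧
      ∀ x, comparison S D (φ, x) ∈ preprojectiveRep S D Q := by
  classical
  let τ : (Fin 2 → ℂ) ≃ₗ[ℂ] S.U (D.p k₀) := LinearEquiv.ofBijective
    (LinearMap.proj k₀ ∘ₗ D.iso.toLinearMap) ⟨fun x y h => D.iso.injective (funext fun k => by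
      obtain rfl := hK k
      exact h), fun u => by
        obtain ⟨x, hx⟩ := D.iso.surjective (fun k => hK k ▸ u)
        exact ⟨x, congrFun hx k₀⟩⟩
  have hτ : ∀ (g : Γ) x, τ (g.1.1.mulVec x) = S.rep (D.p k₀) g (τ x) := fun g x =>
    D.equivariant g x k₀
  -- An injective ranking of the vertices with the trivial one lowest. It orients the quiver.
  let r : I → ℕ := fun i => if i = S.zero then 0 else Fintype.equivFin I i + 1
  have hr : Function.Injective r := fun i j h => by
    simp only [r] at h
    split_ifs at h with h1 h2 h2
    · rw [h1, h2]
    · exact (Fintype.equivFin I).injective (Fin.ext (by lia))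
  obtain ⟨b, hl, hr1, hb⟩ := exists_paired_bases hτ hr (if_pos rfl)
  have hφ := S.isRegular_datumOfBases b hl hr1
  have hcg : ∀ k i j, S.cg i (D.p k) j = S.cg j (D.p k) i := fun k i j => by
    rw [hK k]
    exact cg_symm hτ i j
  let Q : KleinianQuiver S D :=
    { star := fun {i j} a => ⟨a.1, Fin.cast (hcg a.1 i j) a.2⟩
      star_star := fun a => rfl
      pos := fun {i j} _ => decide (r i < r j)
      pos_star := fun {i j} a => by
        have hij : r i ≠ r j := fun h => by
          obtain rfl := hr h
          have h0 := cg_self_eq_zero hτ i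
          rw [← hK a.1] at h0
          exact absurd a.2.2 (by lia)
        rw [← decide_not, decide_eq_decide]
        lia }
  refine ⟨Q, S.datumOfBases b, hφ, fun x => ?_⟩
  rw [mem_preprojectiveRep_iff]
  intro v
  refine LinearMap.ext fun u => ?_
  have h := sum_sharp_eq hτ (ε := fun i j => if r i < r j then 1 else -1)
    (fun i j => by split_ifs <;> norm_num) hb v (u ⊗ₜ τ x)
  -- Contracted with `x`, the completeness identity for `u ⊗ τ x` has the preprojective relation on
  -- the left and a multiple of `planeForm x x = 0` on the right.
  have h' := LinearMap.congr_fun (congrArg (contract τ v) h) x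
  simp only [map_sum, map_smul, LinearMap.sum_apply, LinearMap.smul_apply, contract_sharp,
    contract_tmul, planeForm_apply, LinearEquiv.symm_apply_apply] at h'
  rw [mul_comm, sub_self, zero_smul, smul_zero] at h'
  rw [relation_apply, LinearMap.zero_apply, ← h']
  refine Finset.sum_congr rfl fun j _ => ?_
  rw [Fintype.sum_sigma, Finset.sum_eq_single k₀ (fun k _ hk => absurd (hK k) hk) (by simp)]
  refine Finset.sum_congr rfl fun s _ => ?_
  congr 1
  simp [KleinianQuiver.sign, Q]

variable (S D) in
/-- The existence of a preprojective regular datum. -/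
theorem exists_preprojective : ∃ (Q : KleinianQuiver S D) (φ : CGDatum S), IsRegular S φ ∧
    ∀ x, comparison S D (φ, x) ∈ preprojectiveRep S D Q := by
  classical
  have hsum : ∑ k, S.dim (D.p k) = 2 := by
    simpa [Module.finrank_pi_fintype] using D.iso.finrank_eq.symm
  have hpos : ∀ k, 1 ≤ S.dim (D.p k) := fun k =>
    Nat.one_le_iff_ne_zero.2 fun h => dim_ne_zero (S := S) (D.p k) (by simp [h])
  have hcard : Fintype.card K ≤ 2 := by
    rw [← hsum, ← Finset.card_univ, Finset.card_eq_sum_ones]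
    exact Finset.sum_le_sum fun k _ => hpos k
  have hcard0 : Fintype.card K ≠ 0 := fun h => by
    have := Fintype.card_eq_zero_iff.1 h
    simp at hsum
  obtain h1 | h2 : Fintype.card K = 1 ∨ Fintype.card K = 2 := by lia
  · obtain ⟨k₀, hK⟩ := Fintype.card_eq_one_iff.1 h1
    exact exists_preprojective_of_irreducible hK
  · obtain ⟨k₀, k₁, hne, huniv⟩ := Finset.card_eq_two.1 (Finset.card_univ.trans h2)
    have hK : ∀ k, k = k₀ ∨ k = k₁ := fun k => by
      simpa [huniv] using Finset.mem_univ k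
    rw [huniv, Finset.sum_pair hne] at hsum
    refine exists_preprojective_of_reducible (fun k => ?_) hne hK
    have h0 := hpos k₀
    have h1 := hpos k₁
    rcases hK k with rfl | rfl <;> lia

end Existence

end ClebschGordan

namespace ClebschGordan

/-! ### The two isomorphisms -/

theorem bilinear_pair_mem_coordRing {A B C : Type} [AddCommGroup A] [Module ℂ A]
    [AddCommGroup B] [Module ℂ B] [FiniteDimensional ℂ B] [AddCommGroup C] [Module ℂ C]
    (β : A →ₗ[ℂ] B →ₗ[ℂ] C) (X : Set (A × B)) (l : Module.Dual ℂ C) :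
    (fun z : X => l (β z.1.1 z.1.2)) ∈ coordRing X := by
  let b := Module.finBasis ℂ B
  have : (fun z : X => l (β z.1.1 z.1.2)) = fun z : X => ∑ j,
      (b.coord j ∘ₗ LinearMap.snd ℂ A B) z.1 * (l ∘ₗ β.flip (b j) ∘ₗ LinearMap.fst ℂ A B) z.1 := by
    funext z
    conv_lhs => rw [← b.sum_repr z.1.2]
    simp only [map_sum, map_smul, smul_eq_mul]
    rfl
  rw [this]
  exact sum_mem_coordRing _ fun j _ =>
    mul_mem_coordRing (dual_mem_coordRing X _) (dual_mem_coordRing X _)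

section Kleinian

variable {Γ : Subgroup (Matrix.SpecialLinearGroup (Fin 2) ℂ)} {I K : Type} [Fintype I]
  [Fintype K] {S : SimpleReps Γ I} {D : Decomposition S K} {φ : CGDatum S}
  {Q : KleinianQuiver S D}

omit [Fintype I] [Fintype K] in
theorem dual_comparison_mem_coordRing (X : Set (CGDatum S × (Fin 2 → ℂ)))
    (l : Module.Dual ℂ (DoubleRep S D)) :
    (fun z : X => l (comparison S D z.1)) ∈ coordRing X := by
  have h := bilinear_pair_mem_coordRing (comparisonBilin S D) X l
  exact h

/-- The pullback along the comparison map. -/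
def comparisonPullback (hR : ∀ z ∈ cgPlane S φ, comparison S D z ∈ preprojectiveRep S D Q) :
    invariantRing (gaugeRep S D) (preprojectiveRep S D Q) →ₐ[ℂ]
      invariantRing (gaugePair S D) (cgPlane S φ) where
  toFun f := ⟨fun z => f.1 ⟨comparison S D z.1, hR z.1 z.2⟩,
    comp_mem_coordRing (fun z : cgPlane S φ => (⟨comparison S D z.1, hR z.1 z.2⟩ :
      preprojectiveRep S D Q)) (fun l => dual_comparison_mem_coordRing (cgPlane S φ) l) f.2.1,
    fun g z z' h => f.2.2 g _ _ (by rw [← comparison_gaugePair, h])⟩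
  map_one' := rfl
  map_mul' _ _ := rfl
  map_zero' := rfl
  map_add' _ _ := rfl
  commutes' _ := rfl

omit [Fintype I] [Fintype K] in
theorem exists_restriction (f : invariantRing (gaugePair S D) (cgPlane S φ)) :
    ∃ q ∈ stabInvariants S D φ, ∀ x, MvPolynomial.eval x q = f.1 (basePoint S φ x) := by
  have hf : (fun x : (Set.univ : Set (Fin 2 → ℂ)) => f.1 (basePoint S φ x)) ∈
      coordRing (Set.univ : Set (Fin 2 → ℂ)) := by
    refine comp_mem_coordRing (fun x : (Set.univ : Set (Fin 2 → ℂ)) => basePoint S φ x)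
      (fun l => ?_) f.2.1
    have h : (fun x : (Set.univ : Set (Fin 2 → ℂ)) => l (basePoint S φ x).1) =
        fun x => l (φ, 0) + (l ∘ₗ LinearMap.inr ℂ (CGDatum S) (Fin 2 → ℂ)) x.1 := by
      funext x
      rw [LinearMap.comp_apply, ← map_add]
      simp [basePoint]
    rw [h]
    exact add_mem (const_mem_coordRing _ _) (dual_mem_coordRing _ _)
  obtain ⟨q, hq⟩ := exists_mvPolynomial hf
  refine ⟨q, fun g hg x => ?_, hq⟩
  rw [hq, hq]
  refine f.2.2 g (basePoint S φ x) (basePoint S φ (gaugePlane S D g x)) ?_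
  simp [gaugePair, basePoint, hg]

/-- The polynomial `x ↦ f (φ, x)`. -/
def restrictionPolynomial (f : invariantRing (gaugePair S D) (cgPlane S φ)) :
    stabInvariants S D φ :=
  ⟨(exists_restriction f).choose, (exists_restriction f).choose_spec.1⟩

omit [Fintype I] [Fintype K] in
theorem eval_restrictionPolynomial (f : invariantRing (gaugePair S D) (cgPlane S φ))
    (x : Fin 2 → ℂ) :
    MvPolynomial.eval x (restrictionPolynomial f).1 = f.1 (basePoint S φ x) :=
  (exists_restriction f).choose_spec.2 x

/-- The restriction to the points `(φ, x)`. -/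
def restrictionHom : invariantRing (gaugePair S D) (cgPlane S φ) →ₐ[ℂ] stabInvariants S D φ :=
  AlgHom.ofLinearMap
    { toFun := restrictionPolynomial
      map_add' := fun f g => Subtype.ext <| MvPolynomial.funext fun x => by
        simp [eval_restrictionPolynomial]
      map_smul' := fun c f => Subtype.ext <| MvPolynomial.funext fun x => by
        simp [eval_restrictionPolynomial] }
    (Subtype.ext <| MvPolynomial.funext fun x => by simp [eval_restrictionPolynomial])
    (fun f g => Subtype.ext <| MvPolynomial.funext fun x => by simp [eval_restrictionPolynomial])

omit [Fintype I] [Fintype K] in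
theorem eval_restrictionHom (f : invariantRing (gaugePair S D) (cgPlane S φ)) (x : Fin 2 → ℂ) :
    MvPolynomial.eval x (restrictionHom f).1 = f.1 (basePoint S φ x) :=
  eval_restrictionPolynomial f x

omit [Fintype I] [Fintype K] in
-- Invariance carries the vanishing from `φ` to its orbit. For fixed `x` the function is regular in
-- the first variable, so it vanishes on the closure too.
theorem restrictionHom_injective :
    Function.Injective (restrictionHom (S := S) (D := D) (φ := φ)) := by
  rw [injective_iff_map_eq_zero]
  intro f hf
  have hbase : ∀ x, f.1 (basePoint S φ x) = 0 := fun x => by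
    rw [← eval_restrictionHom, hf]; simp
  obtain ⟨F, hF, hFf⟩ := exists_extension f.2.1
  have horbit : ∀ (g : gaugeGroup S) (x : Fin 2 → ℂ), F ⟨(gaugeCG S g φ, x), trivial⟩ = 0 := by
    intro g x
    have hmem : (gaugeCG S g φ, x) ∈ cgPlane S φ := ⟨fun _ _ h => h _ ⟨g, rfl⟩, trivial⟩
    rw [hFf ⟨_, hmem⟩, ← hbase (gaugePlane S D g⁻¹ x)]
    refine f.2.2 g (basePoint S φ (gaugePlane S D g⁻¹ x)) ⟨_, hmem⟩ ?_
    simp [gaugePair, basePoint, gaugePlane_gaugePlane_inv]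
  refine Subtype.ext (funext fun z => ?_)
  obtain ⟨⟨ψ, x⟩, hψ, hx⟩ := z
  rw [← hFf]
  refine hψ (fun ψ => F ⟨(ψ.1, x), trivial⟩) ?_ ?_
  · refine comp_mem_coordRing (fun ψ : (Set.univ : Set (CGDatum S)) =>
      (⟨(ψ.1, x), trivial⟩ : (Set.univ : Set (CGDatum S × (Fin 2 → ℂ))))) (fun l => ?_) hF
    have h : (fun ψ : (Set.univ : Set (CGDatum S)) => l (ψ.1, x)) =
        fun ψ => (l ∘ₗ LinearMap.inl ℂ (CGDatum S) (Fin 2 → ℂ)) ψ.1 + l (0, x) := by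
      funext ψ
      rw [LinearMap.comp_apply, ← map_add]
      simp
    rw [h]
    exact add_mem (dual_mem_coordRing _ _) (const_mem_coordRing _ _)
  · rintro _ ⟨g, rfl⟩
    exact horbit g x

theorem restrictionHom_comp_surjective [Finite Γ] (hφ : IsRegular S φ)
    (hR : ∀ z ∈ cgPlane S φ, comparison S D z ∈ preprojectiveRep S D Q) :
    Function.Surjective (restrictionHom.comp (comparisonPullback hR)) := by
  intro q
  obtain ⟨f, hf, hfq⟩ := exists_invariant_extension hφ Q q.2
  refine ⟨⟨f, hf⟩, Subtype.ext (MvPolynomial.funext fun x => ?_)⟩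
  rw [AlgHom.comp_apply, eval_restrictionHom]
  exact hfq x (hR _ (basePoint S φ x).2)

theorem comparisonPullback_injective [Finite Γ] (hφ : IsRegular S φ)
    (hR : ∀ z ∈ cgPlane S φ, comparison S D z ∈ preprojectiveRep S D Q) :
    Function.Injective (comparisonPullback hR) := by
  intro f f' h
  refine Subtype.ext (funext fun ρ => ?_)
  obtain ⟨x, hx⟩ := exists_forall_invariant_eq hφ (fun x => hR _ (basePoint S φ x).2) ρ
  rw [hx f.1 f.2, hx f'.1 f'.2]
  exact congrFun (congrArg Subtype.val h) (basePoint S φ x)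

/-- Surjectivity of the composite makes the restriction surjective. As the restriction is also
injective, the pullback is surjective as well. -/
theorem isomorphisms_of_regular [Finite Γ] (hφ : IsRegular S φ)
    (hR : ∀ z ∈ cgPlane S φ, comparison S D z ∈ preprojectiveRep S D Q) :
    Function.Bijective (comparisonPullback hR) ∧
      Function.Bijective (restrictionHom (S := S) (D := D) (φ := φ)) := by
  have h1 := restrictionHom_comp_surjective hφ hR
  have h2 : Function.Bijective (restrictionHom (S := S) (D := D) (φ := φ)) :=
    ⟨restrictionHom_injective, Function.Surjective.of_comp (g := comparisonPullback hR) h1⟩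
  refine ⟨⟨comparisonPullback_injective hφ hR, fun f => ?_⟩, h2⟩
  obtain ⟨f', hf'⟩ := h1 (restrictionHom f)
  exact ⟨f', h2.1 hf'⟩

end Kleinian

end ClebschGordan

end

theorem mainTheorem2
    (Γ : Subgroup (Matrix.SpecialLinearGroup (Fin 2) ℂ)) [Finite Γ]
    {I K : Type} [Fintype I] [Fintype K]
    (S : ClebschGordan.SimpleReps Γ I) (D : ClebschGordan.Decomposition S K) :
    -- regular data for which `R` takes values in `Rep(Π_Q, α)` exist
    (∃ (Q : ClebschGordan.KleinianQuiver S D) (φ₀ : ClebschGordan.CGDatum S),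
      ClebschGordan.IsRegular S φ₀ ∧
      ∀ z ∈ ClebschGordan.cgPlane S φ₀,
        ClebschGordan.comparison S D z ∈ ClebschGordan.preprojectiveRep S D Q) ∧
    -- for all of them (it suffices to test the relations at `φ₀`), both maps are isomorphisms
    (∀ (Q : ClebschGordan.KleinianQuiver S D) (φ₀ : ClebschGordan.CGDatum S),
      ClebschGordan.IsRegular S φ₀ →
      (∀ x : Fin 2 → ℂ,
        ClebschGordan.comparison S D (φ₀, x) ∈ ClebschGordan.preprojectiveRep S D Q) →
      ∃ (hR : ∀ z ∈ ClebschGordan.cgPlane S φ₀,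
          ClebschGordan.comparison S D z ∈ ClebschGordan.preprojectiveRep S D Q)
        (Rstar :
          ClebschGordan.invariantRing (ClebschGordan.gaugeRep S D)
            (ClebschGordan.preprojectiveRep S D Q) ≃ₐ[ℂ]
          ClebschGordan.invariantRing (ClebschGordan.gaugePair S D)
            (ClebschGordan.cgPlane S φ₀))
        (π :
          ClebschGordan.invariantRing (ClebschGordan.gaugePair S D)
            (ClebschGordan.cgPlane S φ₀) ≃ₐ[ℂ]
          ClebschGordan.stabInvariants S D φ₀),
        (∀ f z, (Rstar f).1 z = f.1 ⟨ClebschGordan.comparison S D z.1, hR z.1 z.2⟩) ∧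
        (∀ f x, MvPolynomial.eval x (π f).1 = f.1 (ClebschGordan.basePoint S φ₀ x))) := by
  refine ⟨?_, fun Q φ₀ hφ hQ => ?_⟩
  · obtain ⟨Q, φ₀, hφ, hQ⟩ := ClebschGordan.exists_preprojective S D
    exact ⟨Q, φ₀, hφ, ClebschGordan.comparison_mem_preprojectiveRep Q hQ⟩
  · have hR := ClebschGordan.comparison_mem_preprojectiveRep Q hQ
    obtain ⟨h1, h2⟩ := ClebschGordan.isomorphisms_of_regular hφ hR
    exact ⟨hR, AlgEquiv.ofBijective _ h1, AlgEquiv.ofBijective _ h2, fun _ _ => rfl,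
      fun f x => ClebschGordan.eval_restrictionHom f x⟩
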